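/- Let $R$ be an associative unital ring (not necessarily commutative); modules are left modules unless stated otherwise. For a discrete projective right $R$-module $Q$ let $Q^*=\operatorname{Hom}_R(Q,R)$ be the left $R$-module of right-linear maps with the topology of pointwise convergence ($R$ discrete). An elementary Tate $R$-module is a topological $R$-module isomorphic to $P\oplus Q^*$ with $P$ a discrete projective left $R$-module and $Q$ a discrete projective right $R$-module; a Tate $R$-module is a direct summand (as a topological $R$-module) of an elementary one. A lattice in a topological $R$-module $M$ is an open submodule $L$ such that $L/U$ is finitely generated for every open submodule $U\subset L$. A continuous $R$-linear endomorphism $T$ of a Tate $R$-module $M$ is topologically nilpotent if for all lattices $L,L'\subset M$ there is $N$ such that $T^nL'\subset L$ for all $n>N$. Give $R((t))$ the topology in which the subgroups $t^nR[[t]]$, $n\in\mathbb Z$, form a base of neighbourhoods of $0$. A topology on an $R((t))$-module $M$ is called standard if it makes $M$ a topological $R((t))$-module for which every $R((t))$-linear map $M\to R((t))$ is continuous. (1) Let $M$ be a Tate $R$-module and $T:M\to M$ a topologically nilpotent automorphism (an $R$-linear homeomorphism). Then there is a unique structure of topological $R((t))$-module on $M$ that extends the $R$-module structure and satisfies $tm=T(m)$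 for all $m\in M$. With this structure $M$ is a finitely generated projective $R((t))$-module, and the topology of $M$ is standard. (2) Conversely, every finitely generated projective $R((t))$-module $M$ has a unique standard topology; with this topology $M$ is a Tate $R$-module, and multiplication by $t$ is a topologically nilpotent automorphism of $M$. (3) If $M,N$ are finitely generated projective $R((t))$-modules with their standard topologies, then a map $f:M\to N$ is $R((t))$-linear if and only if it is continuous, $R$-linear, and satisfies $f(tm)=tf(m)$ for all $m\in M$. Thus finitely generated projective $R((t))$-modules are the same as Tate $R$-modules equipped with a topologically nilpotent automorphism. -/

import Mathlib

open scoped LaurentSeries Topology MulOpposite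

universe u v

/-- The dual `Q^* = Hom_R(Q, R)` of a right `R`-module `Q` (a right module is a module over `Rᵐᵒᵖ`).
It is a left `R`-module through `(r • f) q = r * f q`. -/
def RightDual (R : Type u) (Q : Type v) [Ring R] [AddCommGroup Q] [Module Rᵐᵒᵖ Q] :
    Type (max u v) :=
  Q →ₗ[Rᵐᵒᵖ] R

namespace RightDual

variable (R : Type u) (Q : Type v) [Ring R] [AddCommGroup Q] [Module Rᵐᵒᵖ Q]

noncomputable instance instAddCommGroup : AddCommGroup (RightDual R Q) :=
  inferInstanceAs (AddCommGroup (Q →ₗ[Rᵐᵒᵖ] R))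

noncomputable instance instModule : Module R (RightDual R Q) :=
  inferInstanceAs (Module R (Q →ₗ[Rᵐᵒᵖ] R))

/-- The topology on the dual of a discrete module `Q`: pointwise convergence, with `R` discrete.
The orthogonal complements of the finitely generated submodules of `Q` form a base of
neighbourhoods of `0`. -/
instance instTopologicalSpace : TopologicalSpace (RightDual R Q) :=
  TopologicalSpace.induced (fun (f : Q →ₗ[Rᵐᵒᵖ] R) (q : Q) => f q)
    (@Pi.topologicalSpace Q (fun _ => R) (fun _ => ⊥))

end RightDual

/-- Elementary Tate modules: topological `R`-modules isomorphic to `P ⊕ Q^*`, where `P` is a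
discrete projective left module and `Q` is a discrete projective right module. -/
def IsElementaryTateModule (R : Type u) (E : Type v) [Ring R] [AddCommGroup E] [Module R E]
    [TopologicalSpace E] : Prop :=
  ∃ (P : Type (max u v)) (_ : AddCommGroup P) (_ : Module R P) (_ : TopologicalSpace P)
    (Q : Type (max u v)) (_ : AddCommGroup Q) (_ : Module Rᵐᵒᵖ Q),
    DiscreteTopology P ∧ Module.Projective R P ∧ Module.Projective Rᵐᵒᵖ Q ∧
      Nonempty (E ≃L[R] P × RightDual R Q)

/-- Tate modules: direct summands of elementary Tate modules, in the category of topological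
`R`-modules and continuous homomorphisms. -/
def IsTateModule (R : Type u) (M : Type v) [Ring R] [AddCommGroup M] [Module R M]
    [TopologicalSpace M] : Prop :=
  ∃ (E : Type (max u v)) (_ : AddCommGroup E) (_ : Module R E) (_ : TopologicalSpace E),
    IsElementaryTateModule R E ∧
      ∃ (i : M →L[R] E) (p : E →L[R] M), ∀ m, p (i m) = m

/-- A lattice: an open submodule `L` such that `L / U` is finitely generated for every open
submodule `U ⊆ L`. -/
def IsTateLattice {R : Type u} {M : Type v} [Ring R] [AddCommGroup M] [Module R M]
    [TopologicalSpace M] (L : Submodule R M) : Prop :=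
  IsOpen (L : Set M) ∧
    ∀ U : Submodule R M, IsOpen (U : Set M) → U ≤ L → Module.Finite R (L ⧸ U.submoduleOf L)

/-- Topologically nilpotent endomorphisms: for all lattices `L`, `L'` one has `T ^ n L' ⊆ L`
for all sufficiently large `n`. -/
def IsTopNilpotentEnd {R : Type u} {M : Type v} [Ring R] [AddCommGroup M] [Module R M]
    [TopologicalSpace M] (T : M →L[R] M) : Prop :=
  ∀ L L' : Submodule R M, IsTateLattice L → IsTateLattice L' →
    ∃ N : ℕ, ∀ n > N, ∀ m ∈ L', T^[n] m ∈ L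

/-- The `t`-adic topology of `R((t))`: the subgroups `t ^ n R[[t]]`, `n ∈ ℤ`, form a base of
neighbourhoods of `0`. -/
@[reducible] def laurentTopology (R : Type u) [Ring R] : TopologicalSpace R⸨X⸩ where
  IsOpen U := ∀ f ∈ U, ∃ n : ℤ, ∀ g : R⸨X⸩, (∀ k < n, (g - f).coeff k = 0) → g ∈ U
  isOpen_univ := fun _ _ => ⟨0, fun _ _ => trivial⟩
  isOpen_inter := fun U V hU hV f hf => by
    obtain ⟨a, ha⟩ := hU f hf.1
    obtain ⟨b, hb⟩ := hV f hf.2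
    exact ⟨max a b, fun g hg => ⟨ha g fun k hk => hg k (lt_max_of_lt_left hk),
      hb g fun k hk => hg k (lt_max_of_lt_right hk)⟩⟩
  isOpen_sUnion := fun S hS f ⟨U, hU, hf⟩ => by
    obtain ⟨n, hn⟩ := hS U hU f hf
    exact ⟨n, fun g hg => ⟨U, hU, hn g hg⟩⟩

attribute [local instance] laurentTopology

/-- The element `t` of `R((t))`. -/
noncomputable def laurentT (R : Type u) [Ring R] : R⸨X⸩ := HahnSeries.single 1 1

/-- The topology of `M` is standard: `M` is a topological `R((t))`-module and every
`R((t))`-linear map `M → R((t))` is continuous. -/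
def IsStandardTopology (R : Type u) (M : Type v) [Ring R] [AddCommGroup M] [Module R⸨X⸩ M]
    [TopologicalSpace M] : Prop :=
  IsTopologicalAddGroup M ∧ ContinuousSMul R⸨X⸩ M ∧ ∀ f : M →ₗ[R⸨X⸩] R⸨X⸩, Continuous f

/-- The given `R((t))`-module structure on the topological `R`-module `M` extends the `R`-module
structure, makes `M` a topological `R((t))`-module, and `t` acts as `T`. -/
def IsLaurentStructure (R : Type u) (M : Type v) [Ring R] [AddCommGroup M] [Module R M]
    [TopologicalSpace M] (T : M →L[R] M) (inst : Module R⸨X⸩ M) : Prop :=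
  IsScalarTower R R⸨X⸩ M ∧ IsTopologicalAddGroup M ∧ ContinuousSMul R⸨X⸩ M ∧
    ∀ m : M, laurentT R • m = T m

/-! Since `Q` is projective, `Q^*` is a retract of a power of `R`. Hence every Tate module `M` is a
retract of some `P × (J → R)` with `P` discrete projective, which makes it Hausdorff, complete for
series, and rich in lattices.

Given `T`, pick a lattice `L₀` and put `L = ∑ T^j L₀` over `j ≥ 0`. The submodules `F n = T^n L`
form a base at `0` and exhaust `M`, and `F 0` is finitely generated modulo `F 1`
(`exists_shifted_filtration`). Convergent series then define the action of `R((t))`; it is unique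
because Laurent polynomials are dense. Generators of `F 0` modulo `F 1` give a map `π : R((t))^d →
M`, surjective by successive approximation.

Projectivity needs an `R((t))`-linear section of `π`. A continuous `R`-linear section `s` exists: on
`P` by projectivity, on `J → R` because maps out of it are approximated by maps of finite rank
(`exists_section`). The defect `D = t s - s t` lies in `ker π`, and `s + h` commutes with `t` as
soon as `h t - t h = D` with `h` valued in `ker π`. The part of `D` that factors through `J → R` has
bounded image, so `h = ∑ t^n D t^(-n-1)` converges. The part that factors through `P` has open
kernel, so `h = -∑ t^(-n-1) D t^n` converges (`exists_laurent_section`).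

Conversely, a finitely generated projective module is a retract of some `R((t))^ι`, and standardness
forces the induced topology. Polar and nonnegative parts present `R((t))^ι` as a discrete free
module plus a power of `R`. Lattices are bounded for the `t`-adic filtration, whence nilpotence.
Morphisms are compared on monomials and then by density. -/

namespace LaurentTate

open Filter

/-! ### The topological ring `R((t))` and the density of Laurent polynomials. -/

section Laurent

variable {R : Type u} [Ring R]

instance laurent_isScalarTower : IsScalarTower R R⸨X⸩ R⸨X⸩ where
  smul_assoc r f g := by
    rw [smul_eq_mul, smul_eq_mul, ← HahnSeries.single_zero_mul_eq_smul,
      ← HahnSeries.single_zero_mul_eq_smul, mul_assoc]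

variable (R) in
/-- The left submodule `t ^ n R[[t]]` of `R((t))`. -/
def laurentFil (n : ℤ) : Submodule R R⸨X⸩ where
  carrier := {f | ∀ k < n, f.coeff k = 0}
  add_mem' hf hg k hk := by simp [hf k hk, hg k hk]
  zero_mem' k _ := by simp
  smul_mem' r f hf k hk := by simp [hf k hk]

theorem laurentFil_antitone : Antitone (laurentFil R) :=
  fun _ _ h _ hf k hk => hf k (hk.trans_le h)

theorem exists_mem_laurentFil (f : R⸨X⸩) : ∃ n, f ∈ laurentFil R n := by
  rcases eq_or_ne f 0 with rfl | hf
  · exact ⟨0, Submodule.zero_mem _⟩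
  · exact ⟨f.order, fun k hk => HahnSeries.coeff_eq_zero_of_lt_order hk⟩

theorem mul_mem_laurentFil {a b : ℤ} {f g : R⸨X⸩} (hf : f ∈ laurentFil R a)
    (hg : g ∈ laurentFil R b) : f * g ∈ laurentFil R (a + b) := by
  intro k hk
  rw [HahnSeries.coeff_mul]
  refine Finset.sum_eq_zero fun ij hij => ?_
  have h : ij.1 + ij.2 = k := by simpa using (Finset.mem_antidiagonal.1 hij).2.2
  rcases lt_or_ge ij.1 a with h1 | h1
  · rw [hf _ h1, zero_mul]
  · rw [hg _ (by omega), mul_zero]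

theorem single_mem_laurentFil (n : ℤ) (r : R) : HahnSeries.single n r ∈ laurentFil R n :=
  fun _ hk => HahnSeries.coeff_single_of_ne hk.ne

theorem laurent_nhds_basis (f : R⸨X⸩) :
    (𝓝 f).HasBasis (fun _ : ℤ => True) fun n => {g | g - f ∈ laurentFil R n} := by
  refine ⟨fun s => ?_⟩
  rw [mem_nhds_iff]
  constructor
  · rintro ⟨U, hUs, hU, hf⟩
    obtain ⟨n, hn⟩ := hU f hf
    exact ⟨n, trivial, fun g hg => hUs (hn g hg)⟩
  · rintro ⟨n, -, hn⟩
    refine ⟨_, hn, fun g hg => ⟨n, fun h hh => ?_⟩, ?_⟩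
    · have := (laurentFil R n).add_mem hh hg
      rwa [sub_add_sub_cancel] at this
    · simp

theorem laurent_nhds_zero_basis :
    (𝓝 (0 : R⸨X⸩)).HasBasis (fun _ : ℤ => True) fun n => (laurentFil R n : Set R⸨X⸩) := by
  simpa using laurent_nhds_basis (0 : R⸨X⸩)

instance laurent_isTopologicalAddGroup : IsTopologicalAddGroup R⸨X⸩ where
  continuous_add := by
    refine continuous_iff_continuousAt.2 fun ⟨f, g⟩ => ?_
    rw [ContinuousAt, nhds_prod_eq,
      ((laurent_nhds_basis f).prod (laurent_nhds_basis g)).tendsto_iff (laurent_nhds_basis _)]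
    rintro n -
    refine ⟨(n, n), ⟨trivial, trivial⟩, fun x hx => ?_⟩
    have := (laurentFil R n).add_mem hx.1 hx.2
    simpa [add_sub_add_comm] using this
  continuous_neg := by
    refine continuous_iff_continuousAt.2 fun f => ?_
    rw [ContinuousAt, (laurent_nhds_basis f).tendsto_iff (laurent_nhds_basis _)]
    rintro n -
    refine ⟨n, trivial, fun x hx => ?_⟩
    have := (laurentFil R n).neg_mem hx
    simpa [neg_add_eq_sub] using this

instance laurent_isTopologicalRing : IsTopologicalRing R⸨X⸩ := by
  refine IsTopologicalRing.of_addGroup_of_nhds_zero ?_ (fun f => ?_) (fun f => ?_)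
  · rw [(laurent_nhds_zero_basis.prod laurent_nhds_zero_basis).tendsto_iff
      laurent_nhds_zero_basis]
    rintro n -
    refine ⟨(n, 0), ⟨trivial, trivial⟩, fun x hx => ?_⟩
    simpa [Function.uncurry_def] using mul_mem_laurentFil hx.1 hx.2
  · obtain ⟨a, ha⟩ := exists_mem_laurentFil f
    rw [laurent_nhds_zero_basis.tendsto_iff laurent_nhds_zero_basis]
    rintro n -
    refine ⟨n - a, trivial, fun x hx => ?_⟩
    simpa using mul_mem_laurentFil ha hx
  · obtain ⟨a, ha⟩ := exists_mem_laurentFil f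
    rw [laurent_nhds_zero_basis.tendsto_iff laurent_nhds_zero_basis]
    rintro n -
    refine ⟨n - a, trivial, fun x hx => ?_⟩
    simpa using mul_mem_laurentFil hx ha

instance laurent_t2Space : T2Space R⸨X⸩ := by
  refine IsTopologicalAddGroup.t2Space_of_zero_sep fun f hf => ?_
  obtain ⟨n, hn⟩ : ∃ n, f.coeff n ≠ 0 := by
    by_contra! h
    exact hf (HahnSeries.ext (funext h))
  exact ⟨laurentFil R (n + 1), laurent_nhds_zero_basis.mem_of_mem trivial,
    fun h => hn (h n (lt_add_one n))⟩

theorem exists_sub_sum_single_mem (f : R⸨X⸩) (n : ℤ) :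
    ∃ s : Finset ℤ, f - ∑ k ∈ s, HahnSeries.single k (f.coeff k) ∈ laurentFil R n := by
  obtain ⟨a, ha⟩ := exists_mem_laurentFil f
  refine ⟨Finset.Ico a n, fun k hk => ?_⟩
  rw [HahnSeries.coeff_sub, HahnSeries.coeff_sum]
  rcases lt_or_ge k a with h | h
  · rw [ha k h, Finset.sum_eq_zero, sub_zero]
    intro j hj
    exact HahnSeries.coeff_single_of_ne (by have := Finset.mem_Ico.1 hj; omega)
  · rw [Finset.sum_eq_single_of_mem k (Finset.mem_Ico.2 ⟨h, hk⟩)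
      (fun j _ hj => HahnSeries.coeff_single_of_ne hj.symm), HahnSeries.coeff_single_same, sub_self]

/-- A continuous additive map on `R((t))` is determined by its values on monomials. -/
theorem addMonoidHom_ext_single {M : Type*} [AddCommGroup M] [TopologicalSpace M] [T2Space M]
    {φ ψ : R⸨X⸩ →+ M} (hφ : Continuous φ) (hψ : Continuous ψ)
    (h : ∀ k r, φ (HahnSeries.single k r) = ψ (HahnSeries.single k r)) : φ = ψ := by
  have hd : Dense {f : R⸨X⸩ | ∃ s : Finset ℤ, ∃ c : ℤ → R,
      f = ∑ k ∈ s, HahnSeries.single k (c k)} := by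
    intro f
    rw [mem_closure_iff_nhds_basis (laurent_nhds_basis f)]
    rintro n -
    obtain ⟨s, hs⟩ := exists_sub_sum_single_mem f n
    refine ⟨_, ⟨s, f.coeff, rfl⟩, ?_⟩
    have := (laurentFil R n).neg_mem hs
    rwa [neg_sub] at this
  refine DFunLike.coe_injective (Continuous.ext_on hd hφ hψ ?_)
  rintro _ ⟨s, c, rfl⟩
  simp only [map_sum, h]

/-! ### Powers of `t` acting on an `R((t))`-module. -/

section Module

variable {M : Type*} [AddCommGroup M] [Module R M] [Module R⸨X⸩ M] [IsScalarTower R R⸨X⸩ M]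

theorem smul_single_one_smul (k : ℤ) (r : R) (m : M) :
    r • (HahnSeries.single k (1 : R) : R⸨X⸩) • m = (HahnSeries.single k r : R⸨X⸩) • m := by
  rw [← smul_assoc, ← HahnSeries.single_zero_mul_eq_smul, HahnSeries.single_mul_single, zero_add,
    mul_one]

theorem single_zero_smul (r : R) (m : M) : (HahnSeries.single 0 r : R⸨X⸩) • m = r • m := by
  rw [← smul_single_one_smul]
  exact congrArg _ (one_smul R⸨X⸩ m)

theorem single_one_smul_smul (k : ℤ) (r : R) (m : M) :
    (HahnSeries.single k (1 : R) : R⸨X⸩) • r • m = (HahnSeries.single k r : R⸨X⸩) • m := by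
  rw [← single_zero_smul r m, ← mul_smul, HahnSeries.single_mul_single, add_zero, one_mul]

variable (R M) in
/-- Multiplication by `t ^ k` as an `R`-linear map. -/
noncomputable def tpow (k : ℤ) : M →ₗ[R] M where
  toFun m := (HahnSeries.single k (1 : R) : R⸨X⸩) • m
  map_add' := smul_add _
  map_smul' r m := by
    rw [RingHom.id_apply, single_one_smul_smul, smul_single_one_smul]

theorem tpow_apply (k : ℤ) (m : M) : tpow R M k m = (HahnSeries.single k (1 : R) : R⸨X⸩) • m :=
  rfl

theorem single_smul (k : ℤ) (r : R) (m : M) :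
    (HahnSeries.single k r : R⸨X⸩) • m = r • tpow R M k m :=
  (smul_single_one_smul k r m).symm

@[simp]
theorem tpow_zero (m : M) : tpow R M 0 m = m := one_smul R⸨X⸩ m

theorem tpow_tpow (j k : ℤ) (m : M) : tpow R M j (tpow R M k m) = tpow R M (j + k) m := by
  rw [tpow_apply, tpow_apply, tpow_apply, ← mul_smul, HahnSeries.single_mul_single, mul_one]

theorem laurentT_smul (m : M) : laurentT R • m = tpow R M 1 m := rfl

theorem map_tpow {N : Type*} [AddCommGroup N] [Module R N] [Module R⸨X⸩ N]
    [IsScalarTower R R⸨X⸩ N] (f : M → N) (hf : ∀ m, f (tpow R M 1 m) = tpow R N 1 (f m))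
    (k : ℤ) (m : M) : f (tpow R M k m) = tpow R N k (f m) := by
  -- An equivalence, because `t` is invertible on `N`; it drives the integer induction in both
  -- directions.
  have key : ∀ k m, f (tpow R M k m) = tpow R N k (f m) ↔
      f (tpow R M (k + 1) m) = tpow R N (k + 1) (f m) := by
    intro k m
    rw [add_comm, ← tpow_tpow, ← tpow_tpow, hf]
    refine ⟨fun h => by rw [h], fun h => ?_⟩
    have := congrArg (tpow R N (-1)) h
    rwa [tpow_tpow, tpow_tpow, neg_add_cancel, tpow_zero, tpow_zero] at this
  induction k with
  | zero => rw [tpow_zero, tpow_zero]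
  | succ i hi => exact (key _ _).1 hi
  | pred i hi => exact (key _ _).2 (by rwa [sub_add_cancel])

variable [TopologicalSpace M] [ContinuousSMul R⸨X⸩ M]

theorem continuous_tpow (k : ℤ) : Continuous (tpow R M k) := continuous_const_smul _

variable (R M) in
/-- Multiplication by `t ^ k` as a continuous `R`-linear map. -/
noncomputable def tpowL (k : ℤ) : M →L[R] M := ⟨tpow R M k, continuous_tpow k⟩

@[simp]
theorem tpowL_apply (k : ℤ) (m : M) : tpowL R M k m = tpow R M k m := rfl

variable {N : Type*} [AddCommGroup N] [Module R N] [Module R⸨X⸩ N]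
    [IsScalarTower R R⸨X⸩ N] [TopologicalSpace N] [ContinuousSMul R⸨X⸩ N] [T2Space N]

/-- A continuous `R`-linear map commuting with `t` is `R((t))`-linear. -/
theorem map_laurent_smul (f : M →L[R] N) (hf : ∀ m, f (tpow R M 1 m) = tpow R N 1 (f m))
    (a : R⸨X⸩) (m : M) : f (a • m) = a • f m := by
  have := addMonoidHom_ext_single
    (φ := (f : M →+ N).comp ((AddMonoidHom.flip (smulAddHom R⸨X⸩ M)) m))
    (ψ := (AddMonoidHom.flip (smulAddHom R⸨X⸩ N)) (f m))
    (f.continuous.comp (continuous_id.smul continuous_const))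
    (continuous_id.smul continuous_const) (fun k r => by
      change f ((HahnSeries.single k r : R⸨X⸩) • m) = (HahnSeries.single k r : R⸨X⸩) • f m
      rw [single_smul, single_smul, map_smul, map_tpow f hf])
  exact DFunLike.congr_fun this a

end Module

end Laurent

/-! ### Convergent series, filtrations, finite rank approximation. -/

section Topology

/-- Partial sums of sequences tending to zero converge. -/
def SeriesComplete (M : Type*) [AddCommMonoid M] [TopologicalSpace M] : Prop :=
  ∀ x : ℕ → M, Tendsto x atTop (𝓝 0) →
    ∃ s, Tendsto (fun n => ∑ i ∈ Finset.range n, x i) atTop (𝓝 s)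

theorem tendsto_sum_of_eventually_zero {M : Type*} [AddCommMonoid M] [TopologicalSpace M]
    {x : ℕ → M} (h : ∀ᶠ n in atTop, x n = 0) :
    ∃ s, Tendsto (fun n => ∑ i ∈ Finset.range n, x i) atTop (𝓝 s) := by
  obtain ⟨N, hN⟩ := eventually_atTop.1 h
  exact ⟨∑ i ∈ Finset.range N, x i, tendsto_atTop_of_eventually_const (i₀ := N) fun n hn =>
    (Finset.sum_subset (Finset.range_mono hn) fun i _ hi => hN i (by simpa using hi)).symm⟩

theorem seriesComplete_of_discrete (M : Type*) [AddCommMonoid M] [TopologicalSpace M]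
    [DiscreteTopology M] : SeriesComplete M := fun x hx =>
  tendsto_sum_of_eventually_zero (by rwa [nhds_discrete, tendsto_pure] at hx)

theorem SeriesComplete.pi {J : Type*} {M : J → Type*} [∀ j, AddCommMonoid (M j)]
    [∀ j, TopologicalSpace (M j)] (h : ∀ j, SeriesComplete (M j)) :
    SeriesComplete (∀ j, M j) := fun x hx => by
  choose s hs using fun j => h j (fun n => x n j) (tendsto_pi_nhds.1 hx j)
  exact ⟨s, tendsto_pi_nhds.2 fun j => by simpa using hs j⟩

theorem SeriesComplete.prod {M N : Type*} [AddCommMonoid M] [TopologicalSpace M]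
    [AddCommMonoid N] [TopologicalSpace N] (hM : SeriesComplete M) (hN : SeriesComplete N) :
    SeriesComplete (M × N) := fun x hx => by
  obtain ⟨s, hs⟩ := hM (fun n => (x n).1) ((continuous_fst.tendsto _).comp hx)
  obtain ⟨t, ht⟩ := hN (fun n => (x n).2) ((continuous_snd.tendsto _).comp hx)
  refine ⟨(s, t), (hs.prodMk_nhds ht).congr fun n => ?_⟩
  ext <;> simp [Prod.fst_sum, Prod.snd_sum]

theorem SeriesComplete.of_retract {R M E : Type*} [Semiring R] [AddCommMonoid M]
    [TopologicalSpace M] [Module R M] [AddCommMonoid E] [TopologicalSpace E] [Module R E]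
    (hE : SeriesComplete E) (i : M →L[R] E) (p : E →L[R] M) (hpi : ∀ m, p (i m) = m) :
    SeriesComplete M := fun x hx => by
  obtain ⟨s, hs⟩ := hE (fun n => i (x n))
    (by simpa [Function.comp_def] using (i.continuous.tendsto _).comp hx)
  refine ⟨p s, ((p.continuous.tendsto _).comp hs).congr fun n => ?_⟩
  simp [hpi]

variable {R : Type*} [Ring R] {M : Type*} [AddCommGroup M] [Module R M] [TopologicalSpace M]

/-- An exhaustive decreasing filtration by submodules defining the topology. -/
structure IsFil (F : ℤ → Submodule R M) : Prop where
  anti : Antitone F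
  basis : (𝓝 (0 : M)).HasBasis (fun _ : ℤ => True) fun n => (F n : Set M)
  exh : ∀ m, ∃ n, m ∈ F n

theorem isOpen_of_mem_nhds_zero [IsTopologicalAddGroup M] (U : Submodule R M)
    (h : (U : Set M) ∈ 𝓝 0) : IsOpen (U : Set M) :=
  U.toAddSubgroup.isOpen_of_mem_nhds h

theorem isClosed_of_isOpen [IsTopologicalAddGroup M] (U : Submodule R M)
    (h : IsOpen (U : Set M)) : IsClosed (U : Set M) :=
  U.toAddSubgroup.isClosed_of_isOpen h

theorem IsFil.isOpen [IsTopologicalAddGroup M] {F : ℤ → Submodule R M} (hF : IsFil F) (n : ℤ) :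
    IsOpen (F n : Set M) :=
  isOpen_of_mem_nhds_zero _ (hF.basis.mem_of_mem trivial)

theorem IsFil.isClosed [IsTopologicalAddGroup M] {F : ℤ → Submodule R M} (hF : IsFil F)
    (n : ℤ) : IsClosed (F n : Set M) :=
  isClosed_of_isOpen _ (hF.isOpen n)

theorem IsFil.tendsto_zero {F : ℤ → Submodule R M} (hF : IsFil F) {x : ℕ → M} (c : ℤ)
    (hx : ∀ n : ℕ, x n ∈ F (n + c)) : Tendsto x atTop (𝓝 0) := by
  refine hF.basis.tendsto_right_iff.2 fun N _ => ?_
  filter_upwards [eventually_ge_atTop (N - c).toNat] with n hn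
  exact hF.anti (by omega) (hx n)

theorem IsFil.exists_forall_mem {F : ℤ → Submodule R M} (hF : IsFil F) {ι : Type*}
    (s : Finset ι) (x : ι → M) : ∃ n, ∀ j ∈ s, x j ∈ F n := by
  choose n hn using fun j => hF.exh (x j)
  obtain ⟨b, hb⟩ := (s.image n).bddBelow
  exact ⟨b, fun j hj => hF.anti (hb (by simpa using ⟨j, hj, rfl⟩)) (hn j)⟩

variable {X : Type*} [AddCommGroup X] [Module R X] [TopologicalSpace X]
  [IsTopologicalAddGroup X]

/-- Convergent sums of continuous linear maps are continuous linear maps. -/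
theorem exists_sum_continuousLinearMap [IsTopologicalAddGroup M] [T2Space M]
    [ContinuousConstSMul R M] {F : ℤ → Submodule R M}
    (hF : IsFil F) (hM : SeriesComplete M) (u : ℕ → X →L[R] M)
    (h0 : ∀ x, Tendsto (fun n => u n x) atTop (𝓝 0))
    (hu : ∀ N, ∃ U ∈ 𝓝 (0 : X), ∃ n₀ : ℕ, ∀ n ≥ n₀, ∀ x ∈ U, u n x ∈ F N) :
    ∃ v : X →L[R] M, ∀ x, Tendsto (fun n => ∑ i ∈ Finset.range n, u i x) atTop (𝓝 (v x)) := by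
  choose s hs using fun x => hM _ (h0 x)
  let v : X →ₗ[R] M :=
    { toFun := s
      map_add' := fun x y => tendsto_nhds_unique (hs (x + y)) (by
        simpa [Finset.sum_add_distrib] using (hs x).add (hs y))
      map_smul' := fun r x => tendsto_nhds_unique (hs (r • x)) (by
        simpa [Finset.smul_sum] using (hs x).const_smul r) }
  refine ⟨⟨v, continuous_of_continuousAt_zero v ?_⟩, hs⟩
  rw [ContinuousAt, map_zero]
  refine hF.basis.tendsto_right_iff.2 fun N _ => ?_
  obtain ⟨U, hU, n₀, hn₀⟩ := hu N
  -- The tail is controlled on `U`, the first `n₀` terms by their own continuity; `F N` is closed,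
  -- so the limit stays in it.
  have h1 : ∀ᶠ x in 𝓝 (0 : X), ∀ i ∈ Finset.range n₀, u i x ∈ F N := by
    refine (Filter.eventually_all_finset _).2 fun i _ => ?_
    have := (u i).continuous.tendsto 0
    rw [map_zero] at this
    exact this (hF.basis.mem_of_mem (i := N) trivial)
  filter_upwards [hU, h1] with x hx hx1
  refine (hF.isClosed N).mem_of_tendsto (hs x) (Eventually.of_forall fun n => ?_)
  refine Submodule.sum_mem _ fun i _ => ?_
  rcases lt_or_ge i n₀ with hi | hi
  · exact hx1 i (by simpa using hi)
  · exact hn₀ i hi x hx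

/-- The identity is approximated by finite rank maps, uniformly. -/
def FinApprox (R : Type*) [Ring R] (X : Type*) [AddCommGroup X] [Module R X]
    [TopologicalSpace X] [TopologicalSpace R] : Prop :=
  ∀ U : Submodule R X, IsOpen (U : Set X) →
    ∃ (k : ℕ) (l : Fin k → X →L[R] R) (c : Fin k → X), ∀ x, x - ∑ j, l j x • c j ∈ U

-- Modulo `F 0`, the map `v` takes values in the span of the finitely many vectors `v (c j)`, and
-- these lie in a common step of the filtration.
omit [IsTopologicalAddGroup X] in
theorem FinApprox.bounded [TopologicalSpace R] [IsTopologicalAddGroup M] (hX : FinApprox R X)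
    {F : ℤ → Submodule R M} (hF : IsFil F) (v : X →L[R] M) : ∃ n, ∀ x, v x ∈ F n := by
  obtain ⟨k, l, c, h⟩ := hX ((F 0).comap (v : X →ₗ[R] M)) ((hF.isOpen 0).preimage v.continuous)
  obtain ⟨n, hn⟩ := hF.exists_forall_mem Finset.univ fun j => v (c j)
  refine ⟨min n 0, fun x => ?_⟩
  have h1 : v (x - ∑ j, l j x • c j) ∈ F 0 := h x
  rw [← sub_add_cancel x (∑ j, l j x • c j), map_add, map_sum]
  refine add_mem (hF.anti (min_le_right _ _) h1) (Submodule.sum_mem _ fun j hj => ?_)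
  rw [map_smul]
  exact Submodule.smul_mem _ _ (hF.anti (min_le_left _ _) (hn j hj))

variable [TopologicalSpace R]

variable (R) in
theorem finApprox_self : FinApprox R R := fun U _ =>
  ⟨1, fun _ => .id R R, fun _ => 1, fun x => by simp⟩

theorem exists_finset_of_mem_nhds_pi {J : Type*} {W : Set (J → R)} (hW : W ∈ 𝓝 0) :
    ∃ s : Finset J, ∀ x : J → R, (∀ j ∈ s, x j = 0) → x ∈ W := by
  rw [nhds_pi, Filter.mem_pi] at hW
  obtain ⟨I, hI, t, ht, hs⟩ := hW
  refine ⟨hI.toFinset, fun x hx => hs fun j hj => ?_⟩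
  rw [hx j (by simpa using hj)]
  exact mem_of_mem_nhds (ht j)

variable (R) in
/-- The submodule of functions vanishing on a finite set. -/
def vanishing {J : Type*} (s : Finset J) : Submodule R (J → R) where
  carrier := {x | ∀ j ∈ s, x j = 0}
  add_mem' hx hy j hj := by simp [hx j hj, hy j hj]
  zero_mem' j _ := rfl
  smul_mem' r x hx j hj := by simp [hx j hj]

theorem vanishing_isOpen [DiscreteTopology R] {J : Type*} (s : Finset J) : IsOpen (vanishing R s : Set (J → R)) := by
  have : (vanishing R s : Set (J → R)) = (s : Set J).pi fun _ => {0} := by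
    ext x
    simp [vanishing, Set.mem_pi]
  rw [this]
  exact isOpen_set_pi s.finite_toSet fun _ _ => isOpen_discrete _

omit [TopologicalSpace R] in
theorem sub_sum_mem_vanishing {J : Type*} [DecidableEq J] (s : Finset J) (x : J → R) :
    x - ∑ j ∈ s, x j • (Pi.single j 1 : J → R) ∈ vanishing R s := by
  intro i hi
  simp [Finset.sum_apply, Pi.single_apply, hi]

-- An open submodule contains all families that vanish on some finite set of indices, so truncation
-- to that set is the approximation.
variable (R) in
theorem finApprox_pi (J : Type*) : FinApprox R (J → R) := fun U hU => by
  classical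
  obtain ⟨s, hs⟩ := exists_finset_of_mem_nhds_pi (hU.mem_nhds U.zero_mem)
  refine ⟨s.card, fun k => .proj (R := R) (φ := fun _ : J => R) (s.equivFin.symm k : J),
    fun k => Pi.single (s.equivFin.symm k : J) 1, fun x => hs _ ?_⟩
  have := sub_sum_mem_vanishing s x
  rw [← Finset.sum_coe_sort, ← s.equivFin.symm.sum_comp] at this
  exact this

end Topology

/-! ### Duals of projective modules as retracts of powers of `R`. -/

section Dual

variable (R : Type u) (Q : Type v) [Ring R] [AddCommGroup Q] [Module Rᵐᵒᵖ Q]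
  [TopologicalSpace R] [DiscreteTopology R]

/-- A functional on `Q` as a function on `Q`. -/
def rightDualEval : RightDual R Q →L[R] (Q → R) where
  toFun ξ := fun q => (show Q →ₗ[Rᵐᵒᵖ] R from ξ) q
  map_add' _ _ := rfl
  map_smul' _ _ := rfl
  cont := by
    obtain rfl : ‹TopologicalSpace R› = ⊥ := DiscreteTopology.eq_bot
    exact @continuous_induced_dom _ _ _ (@Pi.topologicalSpace Q (fun _ => R) (fun _ => ⊥))

variable {R Q}

theorem continuous_rightDual_iff {Y : Type*} [TopologicalSpace Y] {f : Y → RightDual R Q} :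
    Continuous f ↔ ∀ q, Continuous fun y => rightDualEval R Q (f y) q := by
  obtain rfl : ‹TopologicalSpace R› = ⊥ := DiscreteTopology.eq_bot
  exact continuous_induced_rng.trans (@continuous_pi_iff _ _ _ _ (fun _ => ⊥) _)

omit [TopologicalSpace R] [DiscreteTopology R] in
theorem linearCombination_op_smul {X : Type*} (r : R) (x : X → R) (c : X →₀ Rᵐᵒᵖ) :
    Finsupp.linearCombination Rᵐᵒᵖ (r • x) c = r * Finsupp.linearCombination Rᵐᵒᵖ x c := by
  simp [Finsupp.linearCombination_apply, Finsupp.sum, Finset.mul_sum, mul_assoc]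

omit [TopologicalSpace R] [DiscreteTopology R] in
theorem linearCombination_op_add {X : Type*} (x y : X → R) (c : X →₀ Rᵐᵒᵖ) :
    Finsupp.linearCombination Rᵐᵒᵖ (x + y) c =
      Finsupp.linearCombination Rᵐᵒᵖ x c + Finsupp.linearCombination Rᵐᵒᵖ y c := by
  simp [Finsupp.linearCombination_apply, Finsupp.sum, Finset.sum_add_distrib]

/-- The dual of a linear map from `Q` to a free right module. -/
noncomputable def dualOfLinear {X : Type*} (s : Q →ₗ[Rᵐᵒᵖ] X →₀ Rᵐᵒᵖ) :
    (X → R) →L[R] RightDual R Q where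
  toFun x := (Finsupp.linearCombination Rᵐᵒᵖ x).comp s
  map_add' x y := LinearMap.ext fun q => linearCombination_op_add x y (s q)
  map_smul' r x := LinearMap.ext fun q => linearCombination_op_smul r x (s q)
  cont := by
    refine continuous_rightDual_iff.2 fun q => ?_
    change Continuous fun x : X → R => Finsupp.linearCombination Rᵐᵒᵖ x (s q)
    simp only [Finsupp.linearCombination_apply, Finsupp.sum]
    exact continuous_finsetSum _ fun j _ =>
      (continuous_of_discreteTopology (f := fun r : R => s q j • r)).comp (continuous_apply j)

/-- Obtained by dualizing the splitting of the canonical surjection onto `Q` from the free module on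
the set `Q`. -/
theorem exists_rightDual_retraction [Module.Projective Rᵐᵒᵖ Q] :
    ∃ b : (Q → R) →L[R] RightDual R Q, ∀ ξ, b (rightDualEval R Q ξ) = ξ := by
  obtain ⟨s, hs⟩ := Module.Projective.out (R := Rᵐᵒᵖ) (P := Q)
  refine ⟨dualOfLinear s, fun ξ => LinearMap.ext fun q => ?_⟩
  change Finsupp.linearCombination Rᵐᵒᵖ (show Q →ₗ[Rᵐᵒᵖ] R from ξ) (s q) =
    (show Q →ₗ[Rᵐᵒᵖ] R from ξ) q
  conv_rhs => rw [← hs q, Finsupp.linearCombination_apply, Finsupp.sum, map_sum]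
  rw [Finsupp.linearCombination_apply, Finsupp.sum]
  exact Finset.sum_congr rfl fun j _ => (map_smul _ _ _).symm

theorem exists_retract_of_isTateModule {M : Type v} [AddCommGroup M] [Module R M]
    [TopologicalSpace M] (h : IsTateModule R M) :
    ∃ (P : Type (max u v)) (_ : AddCommGroup P) (_ : Module R P) (_ : TopologicalSpace P)
      (J : Type (max u v)), DiscreteTopology P ∧ Module.Projective R P ∧
        ∃ (i : M →L[R] P × (J → R)) (p : P × (J → R) →L[R] M), ∀ m, p (i m) = m := by
  obtain ⟨E, _, _, _, ⟨P, _, _, _, Q, _, _, hP, hPp, hQ, ⟨e⟩⟩, i, p, hpi⟩ := h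
  obtain ⟨b, hb⟩ := exists_rightDual_retraction (R := R) (Q := Q)
  refine ⟨P, _, _, _, Q, hP, hPp,
    (((ContinuousLinearMap.id R P).prodMap (rightDualEval R Q)).comp (e : E →L[R] _)).comp i,
    (p.comp (e.symm : _ →L[R] E)).comp ((ContinuousLinearMap.id R P).prodMap b), fun m => ?_⟩
  have h1 : (ContinuousLinearMap.id R P).prodMap b
      ((ContinuousLinearMap.id R P).prodMap (rightDualEval R Q) (e (i m))) = e (i m) :=
    Prod.ext rfl (hb _)
  change p (e.symm ((ContinuousLinearMap.id R P).prodMap b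
      ((ContinuousLinearMap.id R P).prodMap (rightDualEval R Q) (e (i m))))) = m
  rw [h1, e.symm_apply_apply, hpi]

end Dual

/-! ### Lattices and the filtration shifted by `T`. -/

section Lattice

variable {R : Type u} {M : Type v} [Ring R] [AddCommGroup M] [Module R M] [TopologicalSpace M]

theorem isTateLattice_iff {L : Submodule R M} :
    IsTateLattice L ↔ IsOpen (L : Set M) ∧ ∀ U : Submodule R M, IsOpen (U : Set M) → U ≤ L →
      ∃ G : Submodule R M, G.FG ∧ G ⊔ U = L := by
  refine and_congr_right fun _ => forall_congr' fun U => forall_congr' fun _ =>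
    forall_congr' fun hUL => ⟨fun h => ?_, ?_⟩
  · obtain ⟨n, s, hs⟩ := Module.Finite.exists_fin (R := R) (M := L ⧸ U.submoduleOf L)
    choose y hy using fun j => Submodule.mkQ_surjective _ (s j)
    refine ⟨Submodule.span R (Set.range fun j => (y j : M)),
      Submodule.fg_span (Set.finite_range _), le_antisymm (sup_le ?_ hUL) fun m hm => ?_⟩
    · rw [Submodule.span_le]
      rintro _ ⟨j, rfl⟩
      exact (y j).2
    · have h1 : Submodule.mkQ (U.submoduleOf L) ⟨m, hm⟩ ∈ Submodule.span R (Set.range s) := by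
        rw [hs]; trivial
      obtain ⟨c, hc⟩ := Submodule.mem_span_range_iff_exists_fun R |>.1 h1
      have h2 : (⟨m, hm⟩ : L) - ∑ j, c j • y j ∈ U.submoduleOf L := by
        rw [← Submodule.Quotient.mk_eq_zero, ← Submodule.mkQ_apply, map_sub, map_sum, ← hc]
        simp [hy]
      have h3 : m - ∑ j, c j • (y j : M) ∈ U := by
        simpa [Submodule.submoduleOf] using h2
      rw [← add_sub_cancel (∑ j, c j • (y j : M)) m]
      exact Submodule.add_mem_sup (Submodule.sum_mem _ fun j _ =>
        Submodule.smul_mem _ _ (Submodule.subset_span ⟨j, rfl⟩)) h3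
  · rintro ⟨G, hG, hGU⟩
    have : Module.Finite R G := Module.Finite.iff_fg.2 hG
    have hGL : G ≤ L := hGU ▸ le_sup_left
    refine Module.Finite.of_surjective
      ((Submodule.mkQ (U.submoduleOf L)).comp (Submodule.inclusion hGL)) fun z => ?_
    obtain ⟨⟨m, hm⟩, rfl⟩ := Submodule.mkQ_surjective _ z
    obtain ⟨g, hg, w, hw, hgw⟩ := Submodule.mem_sup.1 (hGU.symm ▸ hm : m ∈ G ⊔ U)
    refine ⟨⟨g, hg⟩, (Submodule.Quotient.eq _).2 ?_⟩
    have : g - m ∈ U := by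
      rw [← hgw, sub_add_cancel_left]
      exact U.neg_mem hw
    exact this

/-- Every vector thus lies in a lattice, so topological nilpotence can be applied to it. -/
theorem isTateLattice_sup_span_singleton [IsTopologicalAddGroup M] {L : Submodule R M}
    (hL : IsTateLattice L) (m : M) : IsTateLattice (L ⊔ Submodule.span R {m}) := by
  rw [isTateLattice_iff] at hL ⊢
  refine ⟨isOpen_of_mem_nhds_zero _ (mem_of_superset (hL.1.mem_nhds L.zero_mem)
    (le_sup_left : L ≤ _)), fun U hU hUL => ?_⟩
  obtain ⟨G, hG, hGU⟩ := hL.2 (L ⊓ U) (hL.1.inter hU) inf_le_left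
  refine ⟨G ⊔ Submodule.span R {m}, hG.sup (Submodule.fg_span_singleton m), le_antisymm ?_ ?_⟩
  · exact sup_le (sup_le_sup_right (hGU ▸ le_sup_left) _) hUL
  · refine sup_le ?_ (le_sup_right.trans le_sup_left)
    calc L = G ⊔ (L ⊓ U) := hGU.symm
      _ ≤ _ := sup_le_sup le_sup_left inf_le_right

variable {P J : Type*} [AddCommGroup P] [Module R P] [TopologicalSpace P] [DiscreteTopology P]
  [TopologicalSpace R] [DiscreteTopology R] (i : M →L[R] P × (J → R)) (p : P × (J → R) →L[R] M)

omit [DiscreteTopology R] in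
include i in
theorem isTopologicalAddGroup_of_retract [IsTopologicalAddGroup R] (hpi : ∀ m, p (i m) = m) :
    IsTopologicalAddGroup M :=
  (Function.LeftInverse.isEmbedding hpi p.continuous i.continuous).isInducing.topologicalAddGroup i

include i in
theorem t2Space_of_retract (hpi : ∀ m, p (i m) = m) : T2Space M :=
  (Function.LeftInverse.isEmbedding hpi p.continuous i.continuous).t2Space

theorem seriesComplete_of_retract (hpi : ∀ m, p (i m) = m) : SeriesComplete M :=
  ((seriesComplete_of_discrete P).prod
    (SeriesComplete.pi fun _ => seriesComplete_of_discrete R)).of_retract i p hpi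

/-- The images of the standard lattices are arbitrarily small lattices. -/
theorem exists_isTateLattice_subset [IsTopologicalAddGroup M] (hpi : ∀ m, p (i m) = m) {W : Set M}
    (hW : W ∈ 𝓝 0) : ∃ L : Submodule R M, IsTateLattice L ∧ (L : Set M) ⊆ W := by
  classical
  have hin : ∀ V ∈ 𝓝 (0 : M), ∃ s : Finset J, ∀ x : J → R, x ∈ vanishing R s → p (0, x) ∈ V := by
    intro V hV
    refine exists_finset_of_mem_nhds_pi (W := (fun x => p (0, x)) ⁻¹' V) ?_
    refine (p.continuous.comp (Continuous.prodMk_right 0)).continuousAt.preimage_mem_nhds ?_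
    change V ∈ 𝓝 (p 0)
    rwa [map_zero]
  obtain ⟨s, hs⟩ := hin W hW
  let q : (J → R) →ₗ[R] M := (p : _ →ₗ[R] M).comp (LinearMap.inr R P (J → R))
  refine ⟨(vanishing R s).map q, isTateLattice_iff.2 ⟨?_, fun U hU hUL => ?_⟩, ?_⟩
  · refine isOpen_of_mem_nhds_zero _ ?_
    -- This open set lies in the image of `q`: if `i m = (0, x)` then `m = p (0, x)`.
    have h1 : i ⁻¹' (({0} : Set P) ×ˢ (vanishing R s : Set (J → R))) ∈ 𝓝 (0 : M) :=
      (((isOpen_discrete _).prod (vanishing_isOpen s)).preimage i.continuous).mem_nhds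
        (by simp)
    refine mem_of_superset h1 fun m hm => ⟨(i m).2, hm.2, ?_⟩
    have h2 : ((0 : P), (i m).2) = i m := Prod.ext hm.1.symm rfl
    change p ((0 : P), (i m).2) = m
    rw [h2, hpi]
  · obtain ⟨s', hs'⟩ := hin U (hU.mem_nhds U.zero_mem)
    -- Modulo `U` only the coordinates in `s'` count, and those in `s` already vanish.
    refine ⟨Submodule.span R ((fun j => q (Pi.single j 1)) '' (s' \ s : Finset J)),
      Submodule.fg_span ((Finset.finite_toSet _).image _), le_antisymm (sup_le ?_ hUL) ?_⟩
    · rw [Submodule.span_le]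
      rintro _ ⟨j, hj, rfl⟩
      refine ⟨_, fun k hk => ?_, rfl⟩
      have : k ≠ j := by
        rintro rfl
        simp [hk] at hj
      simp [this]
    · rintro _ ⟨x, hx, rfl⟩
      have h1 := sub_sum_mem_vanishing s' x
      rw [← Finset.sum_subset (Finset.sdiff_subset (s := s') (t := s))
        (fun j hj hj' => by
          have : j ∈ s := by simpa [hj] using hj'
          rw [hx j this, zero_smul])] at h1
      have h2 := hs' _ h1
      change q (x - _) ∈ U at h2
      rw [map_sub, map_sum] at h2
      rw [← add_sub_cancel (∑ j ∈ s' \ s, q (x j • (Pi.single j 1 : J → R))) (q x)]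
      refine Submodule.add_mem_sup (Submodule.sum_mem _ fun j hj => ?_) h2
      rw [map_smul]
      exact Submodule.smul_mem _ _ (Submodule.subset_span ⟨j, hj, rfl⟩)
  · rintro _ ⟨x, hx, rfl⟩
    exact hs x hx

omit [TopologicalSpace R] [DiscreteTopology R] in
theorem zpow_zero_apply (T : M ≃L[R] M) (m : M) : (T ^ (0 : ℤ)) m = m := by
  rw [zpow_zero]
  rfl

omit [TopologicalSpace R] [DiscreteTopology R] in
theorem zpow_zpow_apply (T : M ≃L[R] M) (j k : ℤ) (m : M) :
    (T ^ j) ((T ^ k) m) = (T ^ (j + k)) m := by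
  rw [zpow_add]
  rfl

omit [TopologicalSpace R] [DiscreteTopology R] in
theorem iterate_apply_eq_zpow (T : M ≃L[R] M) (n : ℕ) (m : M) :
    (T : M →L[R] M)^[n] m = (T ^ (n : ℤ)) m := by
  induction n with
  | zero => exact (zpow_zero_apply T m).symm
  | succ n ih =>
    rw [Function.iterate_succ_apply', ih, Nat.cast_succ, add_comm, ← zpow_zpow_apply, zpow_one]
    rfl

omit [TopologicalSpace R] [DiscreteTopology R] in
/-- A topologically nilpotent automorphism of a module with enough lattices shifts some
filtration with finitely generated steps. -/
theorem exists_shifted_filtration [IsTopologicalAddGroup M]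
    (hlat : ∀ W ∈ 𝓝 (0 : M), ∃ L : Submodule R M, IsTateLattice L ∧ (L : Set M) ⊆ W)
    (T : M ≃L[R] M) (hT : IsTopNilpotentEnd (T : M →L[R] M)) :
    ∃ F : ℤ → Submodule R M, IsFil F ∧ (∀ n k m, m ∈ F n → (T ^ k) m ∈ F (n + k)) ∧
      ∃ (k : ℕ) (x : Fin k → M), (∀ j, x j ∈ F 0) ∧
        ∀ m ∈ F 0, ∃ r : Fin k → R, m - ∑ j, r j • x j ∈ F 1 := by
  obtain ⟨L₀, hL₀, -⟩ := hlat Set.univ univ_mem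
  let tp : ℤ → M →ₗ[R] M := fun k => ((T ^ k : M ≃L[R] M) : M →L[R] M)
  have tpa : ∀ k m, tp k m = (T ^ k) m := fun _ _ => rfl
  let L : Submodule R M := ⨆ j : ℕ, L₀.map (tp j)
  have hmem : ∀ (j : ℕ) y, y ∈ L₀ → (T ^ (j : ℤ)) y ∈ L := fun j y hy =>
    (le_iSup (fun j : ℕ => L₀.map (tp j)) j) ⟨y, hy, rfl⟩
  have hle : ∀ V : Submodule R M, (∀ (j : ℕ) y, y ∈ L₀ → (T ^ (j : ℤ)) y ∈ V) → L ≤ V := by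
    intro V h
    refine iSup_le fun j => ?_
    rintro _ ⟨y, hy, rfl⟩
    exact h j y hy
  have hstab : ∀ (k : ℕ) y, y ∈ L → (T ^ (k : ℤ)) y ∈ L := fun k =>
    hle (L.comap (tp k)) fun j y hy => by
      rw [Submodule.mem_comap, tpa, zpow_zpow_apply, ← Nat.cast_add]
      exact hmem _ _ hy
  have hL₀L : L₀ ≤ L := fun y hy => by
    have := hmem 0 y hy
    rwa [Nat.cast_zero, zpow_zero_apply] at this
  have hLo : IsOpen (L : Set M) :=
    isOpen_of_mem_nhds_zero _ (mem_of_superset (hL₀.1.mem_nhds L₀.zero_mem) hL₀L)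
  -- This is `T^n L`; it decreases because `L` is stable under nonnegative powers of `T`.
  let F : ℤ → Submodule R M := fun n => L.comap (tp (-n))
  have hF : ∀ n m, m ∈ F n ↔ (T ^ (-n)) m ∈ L := fun _ _ => Iff.rfl
  have hFo : ∀ n, IsOpen (F n : Set M) := fun n => hLo.preimage (T ^ (-n)).continuous
  have hF0 : F 0 = L := by
    ext m
    rw [hF, neg_zero, zpow_zero_apply]
  have hshift : ∀ n k m, m ∈ F n → (T ^ k) m ∈ F (n + k) := by
    intro n k m hm
    rw [hF, zpow_zpow_apply]
    rwa [neg_add, neg_add_cancel_right]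
  refine ⟨F, ⟨fun n n' h m hm => ?_, ⟨fun W => ⟨fun hW => ?_, ?_⟩⟩, fun m => ?_⟩, hshift, ?_⟩
  · rw [hF] at hm ⊢
    obtain ⟨k, hk⟩ := Int.eq_ofNat_of_zero_le (sub_nonneg.2 h)
    have := hstab k _ hm
    rwa [zpow_zpow_apply, show (k : ℤ) + -n' = -n by omega] at this
  · obtain ⟨L₁, hL₁, hW⟩ := hlat W hW
    obtain ⟨N, hN⟩ := hT L₁ L₀ hL₁ hL₀
    refine ⟨(N + 1 : ℕ), trivial, fun m hm => hW ?_⟩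
    -- One `N` serves all summands of `L`, since nilpotence bounds every exponent beyond `N`.
    have h1 : L ≤ L₁.comap (tp (N + 1 : ℕ)) := hle _ fun j y hy => by
      have := hN (N + 1 + j) (by omega) y hy
      rw [Submodule.mem_comap, tpa, zpow_zpow_apply, ← Nat.cast_add]
      rwa [iterate_apply_eq_zpow] at this
    have h2 := h1 hm
    rw [Submodule.mem_comap, tpa, tpa, zpow_zpow_apply, add_neg_cancel, zpow_zero] at h2
    exact h2
  · rintro ⟨n, -, hn⟩
    exact mem_of_superset ((hFo n).mem_nhds (F n).zero_mem) hn
  · obtain ⟨N, hN⟩ := hT L₀ _ hL₀ (isTateLattice_sup_span_singleton hL₀ m)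
    have := hN (N + 1) (by omega) m (Submodule.mem_sup_right (Submodule.mem_span_singleton_self m))
    rw [iterate_apply_eq_zpow] at this
    refine ⟨-(N + 1 : ℕ), ?_⟩
    rw [hF, neg_neg]
    exact hL₀L this
  · rw [isTateLattice_iff] at hL₀
    obtain ⟨G, hG, hGU⟩ := hL₀.2 (L₀ ⊓ F 1) (hL₀.1.inter (hFo 1)) inf_le_left
    obtain ⟨k, x, rfl⟩ := Submodule.fg_iff_exists_fin_generating_family.1 hG
    -- All summands with positive exponent lie in `T L = F 1`, so only `L₀` needs generators.
    have hL : L ≤ L₀ ⊔ F 1 := hle _ fun j y hy => by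
      rcases j with - | j
      · exact Submodule.mem_sup_left (by rwa [Nat.cast_zero, zpow_zero_apply])
      · refine Submodule.mem_sup_right ?_
        rw [hF, zpow_zpow_apply]
        have := hmem j y hy
        rwa [show (-1 + ((j + 1 : ℕ) : ℤ)) = j by push_cast; ring]
    refine ⟨k, x, fun j => ?_, fun m hm => ?_⟩
    · rw [hF0]
      exact hL₀L (hGU ▸ Submodule.mem_sup_left (Submodule.subset_span ⟨j, rfl⟩))
    · rw [hF0] at hm
      obtain ⟨l, hl, f, hf, rfl⟩ := Submodule.mem_sup.1 (hL hm)
      rw [← hGU] at hl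
      obtain ⟨g, hg, w, hw, rfl⟩ := Submodule.mem_sup.1 hl
      obtain ⟨r, rfl⟩ := Submodule.mem_span_range_iff_exists_fun R |>.1 hg
      refine ⟨r, ?_⟩
      rw [add_assoc, add_sub_cancel_left]
      exact add_mem hw.2 hf

end Lattice

/-! ### Existence and uniqueness of the `R((t))`-structure. -/

section Structure

variable {R : Type u} {M : Type v} [Ring R] [AddCommGroup M] [Module R M] [TopologicalSpace M]

theorem IsFil.continuousConstSMul [IsTopologicalAddGroup M] {F : ℤ → Submodule R M}
    (hF : IsFil F) : ContinuousConstSMul R M where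
  continuous_const_smul r := by
    refine continuous_of_continuousAt_zero (DistribSMul.toAddMonoidHom M r) ?_
    rw [ContinuousAt, map_zero]
    exact (hF.basis.tendsto_iff hF.basis).2 fun n _ =>
      ⟨n, trivial, fun m hm => (F n).smul_mem r hm⟩

/-- The map `f ↦ f_k • m` on Laurent series. -/
noncomputable def coeffSMul [IsTopologicalAddGroup M] (k : ℤ) (m : M) : R⸨X⸩ →L[R] M where
  toFun f := f.coeff k • m
  map_add' f g := by rw [HahnSeries.coeff_add, add_smul]
  map_smul' r f := by rw [HahnSeries.coeff_smul, smul_eq_mul, mul_smul, RingHom.id_apply]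
  cont := by
    refine continuous_of_continuousAt_zero (AddMonoidHom.mk' (fun f : R⸨X⸩ => f.coeff k • m)
      fun f g => by rw [HahnSeries.coeff_add, add_smul]) ?_
    rw [ContinuousAt, map_zero]
    refine tendsto_nhds_of_eventually_eq ?_
    filter_upwards [laurent_nhds_zero_basis.mem_of_mem (i := k + 1) trivial] with f hf
    change f.coeff k • m = 0
    rw [hf k (lt_add_one k), zero_smul]

variable [IsTopologicalAddGroup M] [T2Space M] {F : ℤ → Submodule R M} (hF : IsFil F)
  (T : M ≃L[R] M) (hT : ∀ n k m, m ∈ F n → (T ^ k) m ∈ F (n + k))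

include hF hT in
theorem exists_laurentOrbitMap (hM : SeriesComplete M) (m : M) :
    ∃ φ : R⸨X⸩ →L[R] M, ∀ k r, φ (HahnSeries.single k r) = r • (T ^ k) m := by
  have := hF.continuousConstSMul
  obtain ⟨c, hc⟩ := hF.exh m
  -- The sum over `ℤ` is indexed by `ℕ` by pairing the exponents `n` and `-n - 1`; for a given
  -- series the negative terms eventually vanish.
  let u : ℕ → R⸨X⸩ →L[R] M := fun n =>
    coeffSMul (n : ℤ) ((T ^ (n : ℤ)) m) + coeffSMul (-(n : ℤ) - 1) ((T ^ (-(n : ℤ) - 1)) m)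
  have hu : ∀ n f, u n f = f.coeff (n : ℤ) • (T ^ (n : ℤ)) m +
    f.coeff (-(n : ℤ) - 1) • (T ^ (-(n : ℤ) - 1)) m := fun _ _ => rfl
  have hmem : ∀ N, ∀ (n : ℕ) f, -(n : ℤ) ≤ N → f ∈ laurentFil R N → u n f ∈ F (c + n) := by
    intro N n f hn hf
    rw [hu, hf (-(n : ℤ) - 1) (by omega), zero_smul, add_zero]
    exact (F _).smul_mem _ (hT _ _ _ hc)
  obtain ⟨φ, hφ⟩ := exists_sum_continuousLinearMap hF hM u (fun f => by
    obtain ⟨a, ha⟩ := exists_mem_laurentFil f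
    refine hF.basis.tendsto_right_iff.2 fun N _ => ?_
    filter_upwards [eventually_ge_atTop ((N - c).toNat + (-a).toNat)] with n hn
    exact hF.anti (by omega) (hmem a n f (by omega) ha)) (fun N =>
    ⟨_, laurent_nhds_zero_basis.mem_of_mem (i := 0) trivial, (N - c).toNat, fun n hn f hf =>
      hF.anti (by omega) (hmem 0 n f (by omega) hf)⟩)
  -- One of the two `toNat` terms is zero, so their sum is the index `n` of the pair that contains
  -- `k`.
  refine ⟨φ, fun k r => tendsto_nhds_unique (hφ _) (tendsto_atTop_of_eventually_const
    (i₀ := k.toNat + (-k - 1).toNat + 1) fun n hn => ?_)⟩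
  rw [Finset.sum_eq_single_of_mem (k.toNat + (-k - 1).toNat) (Finset.mem_range.2 (by omega))
    fun j _ hj => by
      rw [hu, HahnSeries.coeff_single_of_ne (by omega), HahnSeries.coeff_single_of_ne (by omega),
        zero_smul, zero_smul, add_zero], hu]
  rcases le_or_gt 0 k with h | h
  · rw [show ((k.toNat + (-k - 1).toNat : ℕ) : ℤ) = k by omega, HahnSeries.coeff_single_same,
      HahnSeries.coeff_single_of_ne (by omega), zero_smul, add_zero]
  · rw [show -((k.toNat + (-k - 1).toNat : ℕ) : ℤ) - 1 = k by omega, HahnSeries.coeff_single_same,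
      HahnSeries.coeff_single_of_ne (by omega), zero_smul, zero_add]

/-- The `R((t))`-module structure defined by compatible orbit maps. -/
@[reducible] noncomputable def laurentModule [ContinuousConstSMul R M] (φ : M → R⸨X⸩ →L[R] M)
    (hφ : ∀ m k r, φ m (HahnSeries.single k r) = r • (T ^ k) m) : Module R⸨X⸩ M :=
  have ext : ∀ {α β : R⸨X⸩ →+ M}, Continuous α → Continuous β →
      (∀ k r, α (HahnSeries.single k r) = β (HahnSeries.single k r)) → ∀ f, α f = β f :=
    fun hα hβ h f => DFunLike.congr_fun (addMonoidHom_ext_single hα hβ h) f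
  -- Associativity takes two density arguments: here in the right factor, with a monomial on the
  -- left, and then in the left factor.
  have hsmul : ∀ k r m f, φ m (HahnSeries.single k r * f) = r • (T ^ k) (φ m f) := by
    intro k r m
    refine ext (α := (φ m : R⸨X⸩ →+ M).comp (AddMonoidHom.mulLeft _))
      (β := (DistribSMul.toAddMonoidHom M r).comp
        (((T ^ k : M ≃L[R] M) : M →+ M).comp (φ m : R⸨X⸩ →+ M)))
      ((φ m).continuous.comp (continuous_const_mul _))
      ((continuous_const_smul r).comp ((T ^ k).continuous.comp (φ m).continuous))
      (fun j s => ?_)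
    change φ m (HahnSeries.single k r * HahnSeries.single j s) =
      r • (T ^ k) (φ m (HahnSeries.single j s))
    rw [HahnSeries.single_mul_single, hφ, hφ, map_smul, zpow_zpow_apply, mul_smul]
  have hadd : ∀ m m' f, φ (m + m') f = φ m f + φ m' f := fun m m' =>
    ext (α := (φ (m + m') : R⸨X⸩ →+ M)) (β := (φ m : R⸨X⸩ →+ M) + (φ m' : R⸨X⸩ →+ M))
      (φ (m + m')).continuous ((φ m).continuous.add (φ m').continuous) fun k r => by
        change φ (m + m') (HahnSeries.single k r) =
          φ m (HahnSeries.single k r) + φ m' (HahnSeries.single k r)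
        rw [hφ, hφ, hφ, map_add, smul_add]
  { smul := fun f m => φ m f
    one_smul := fun m => by
      change φ m 1 = m
      rw [← HahnSeries.single_zero_one, hφ, one_smul, zpow_zero_apply]
    zero_smul := fun m => map_zero (φ m)
    add_smul := fun f g m => map_add (φ m) f g
    smul_zero := fun f => by
      have := hadd 0 0 f
      rw [add_zero] at this
      exact left_eq_add.1 this
    smul_add := fun f m m' => hadd m m' f
    mul_smul := fun f g m => by
      refine ext (α := (φ m : R⸨X⸩ →+ M).comp (AddMonoidHom.mulRight g))
        (β := (φ (φ m g) : R⸨X⸩ →+ M)) ((φ m).continuous.comp (continuous_mul_const g))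
        (φ (φ m g)).continuous (fun k r => ?_) f
      change φ m (HahnSeries.single k r * g) = φ (φ m g) (HahnSeries.single k r)
      rw [hsmul, hφ] }

-- `F (a + b)` is open, so `f` may be replaced by a finite sum of its monomials.
omit [T2Space M] in
include hF hT in
theorem laurentOrbitMap_mem (φ : M → R⸨X⸩ →L[R] M)
    (hφ : ∀ m k r, φ m (HahnSeries.single k r) = r • (T ^ k) m) {a b : ℤ} {f : R⸨X⸩} {m : M}
    (hf : f ∈ laurentFil R a) (hm : m ∈ F b) : φ m f ∈ F (a + b) := by
  have h1 : (φ m) ⁻¹' (F (a + b)) ∈ 𝓝 (0 : R⸨X⸩) :=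
    ((hF.isOpen (a + b)).preimage (φ m).continuous).mem_nhds (by simp)
  obtain ⟨n, -, hn⟩ := laurent_nhds_zero_basis.mem_iff.1 h1
  obtain ⟨s, hs⟩ := exists_sub_sum_single_mem f n
  rw [← sub_add_cancel f (∑ k ∈ s, HahnSeries.single k (f.coeff k)), map_add, map_sum]
  refine add_mem (hn hs) (Submodule.sum_mem _ fun k _ => ?_)
  rw [hφ]
  rcases lt_or_ge k a with h | h
  · rw [hf k h, zero_smul]
    exact Submodule.zero_mem _
  · exact (F _).smul_mem _ (hF.anti (by omega) (hT _ k _ hm))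

include hF hT in
theorem exists_isLaurentStructure (hM : SeriesComplete M) :
    ∃ inst : Module R⸨X⸩ M, IsLaurentStructure R M (T : M →L[R] M) inst := by
  have := hF.continuousConstSMul
  choose φ hφ using exists_laurentOrbitMap hF T hT hM
  let := laurentModule T φ hφ
  have hs : ∀ (f : R⸨X⸩) (m : M), f • m = φ m f := fun _ _ => rfl
  have hmem := fun {a b f m} => laurentOrbitMap_mem hF T hT φ hφ (a := a) (b := b) (f := f) (m := m)
  refine ⟨inferInstance, ⟨fun r f m => (φ m).map_smul r f⟩, inferInstance,
    ContinuousSMul.of_nhds_zero ?_ (fun m => ?_) (fun f => ?_), fun m => ?_⟩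
  · rw [(laurent_nhds_zero_basis.prod hF.basis).tendsto_iff hF.basis]
    rintro n -
    refine ⟨(n, 0), ⟨trivial, trivial⟩, fun x hx => ?_⟩
    have := hmem hx.1 hx.2
    rwa [add_zero] at this
  · have := (φ m).continuous.tendsto 0
    rwa [map_zero] at this
  · obtain ⟨a, ha⟩ := exists_mem_laurentFil f
    rw [hF.basis.tendsto_iff hF.basis]
    rintro n -
    refine ⟨n - a, trivial, fun x hx => ?_⟩
    have := hmem ha hx
    rwa [add_sub_cancel] at this
  · change φ m (HahnSeries.single 1 1) = T m
    rw [hφ, one_smul, zpow_one]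

omit [IsTopologicalAddGroup M] [T2Space M] in
theorem tpow_eq_zpow [Module R⸨X⸩ M] [IsScalarTower R R⸨X⸩ M]
    (h : ∀ m : M, laurentT R • m = T m) (k : ℤ) (m : M) : tpow R M k m = (T ^ k) m := by
  have key : ∀ k m, tpow R M k m = (T ^ k) m ↔ tpow R M (k + 1) m = (T ^ (k + 1)) m := by
    intro k m
    rw [add_comm, ← tpow_tpow, ← zpow_zpow_apply, ← laurentT_smul, h, zpow_one,
      T.injective.eq_iff]
  induction k with
  | zero => rw [tpow_zero, zpow_zero_apply]
  | succ i hi => exact (key _ _).1 hi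
  | pred i hi => exact (key _ _).2 (by rwa [sub_add_cancel])

omit [IsTopologicalAddGroup M] in
theorem isLaurentStructure_unique {inst₁ inst₂ : Module R⸨X⸩ M}
    (h₁ : IsLaurentStructure R M (T : M →L[R] M) inst₁)
    (h₂ : IsLaurentStructure R M (T : M →L[R] M) inst₂) : inst₁ = inst₂ := by
  have key : ∀ (inst : Module R⸨X⸩ M), IsLaurentStructure R M (T : M →L[R] M) inst → ∀ m : M,
      ∃ α : R⸨X⸩ →+ M, Continuous α ∧ (∀ f, α f = f • m) ∧
        ∀ k r, α (HahnSeries.single k r) = r • (T ^ k) m := by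
    rintro inst ⟨_, _, _, hT⟩ m
    refine ⟨(AddMonoidHom.flip (smulAddHom R⸨X⸩ M)) m, continuous_id.smul continuous_const,
      fun _ => rfl, fun k r => ?_⟩
    rw [← tpow_eq_zpow T hT, ← single_smul]
    rfl
  refine Module.ext' _ _ fun f m => ?_
  obtain ⟨α, hα, hαs, hα1⟩ := key inst₁ h₁ m
  obtain ⟨β, hβ, hβs, hβ1⟩ := key inst₂ h₂ m
  rw [← hαs, addMonoidHom_ext_single hα hβ fun k r => by rw [hα1, hβ1]]
  exact hβs f

end Structure

/-! ### The free modules `R((t))^ι` as Tate modules. -/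

section Free

variable {R : Type u} [Ring R] {ι : Type v} [Fintype ι]

variable (R ι) in
/-- The submodules `t ^ n R[[t]] ^ ι` of `R((t)) ^ ι`. -/
def piFil (n : ℤ) : Submodule R (ι → R⸨X⸩) :=
  Submodule.pi Set.univ fun _ => laurentFil R n

omit [Fintype ι] in
theorem mem_piFil {n : ℤ} {a : ι → R⸨X⸩} : a ∈ piFil R ι n ↔ ∀ j, a j ∈ laurentFil R n := by
  simp [piFil, Submodule.mem_pi]

theorem piFil_mem_nhds (n : ℤ) : (piFil R ι n : Set (ι → R⸨X⸩)) ∈ 𝓝 0 :=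
  set_pi_mem_nhds Set.finite_univ fun _ _ => laurent_nhds_zero_basis.mem_of_mem trivial

theorem isFil_piFil : IsFil (piFil R ι) where
  anti _ _ h _ ha := mem_piFil.2 fun j => laurentFil_antitone h (mem_piFil.1 ha j)
  basis := by
    refine ⟨fun W => ⟨fun hW => ?_, fun ⟨n, _, hn⟩ => mem_of_superset (piFil_mem_nhds n) hn⟩⟩
    rw [nhds_pi, Filter.mem_pi'] at hW
    obtain ⟨I, t, ht, hW⟩ := hW
    choose n hn using fun j => laurent_nhds_zero_basis.mem_iff.1 (ht j)
    obtain ⟨b, hb⟩ := (I.image n).bddAbove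
    refine ⟨b, trivial, fun a ha => hW fun j hj => (hn j).2 (laurentFil_antitone
      (hb ?_) (mem_piFil.1 ha j))⟩
    simpa using ⟨j, hj, rfl⟩
  exh a := by
    choose n hn using fun j => exists_mem_laurentFil (a j)
    obtain ⟨b, hb⟩ := (Finset.univ.image n).bddBelow
    exact ⟨b, mem_piFil.2 fun j => laurentFil_antitone (hb (by simp)) (hn j)⟩

omit [Fintype ι] in
theorem tpow_mem_piFil {n k : ℤ} {a : ι → R⸨X⸩} (ha : a ∈ piFil R ι n) :
    tpow R _ k a ∈ piFil R ι (n + k) := mem_piFil.2 fun j => by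
  rw [add_comm]
  exact mul_mem_laurentFil (single_mem_laurentFil k 1) (mem_piFil.1 ha j)

/-- The polar part of a family of Laurent series. -/
noncomputable def polarPart : (ι → R⸨X⸩) →ₗ[R] (ι × ℕ →₀ R) where
  toFun a := Finsupp.ofSupportFinite (fun x => (a x.1).coeff (-(x.2 : ℤ) - 1)) (by
    obtain ⟨n, hn⟩ := isFil_piFil.exh a
    refine ((Finset.univ : Finset ι) ×ˢ Finset.range (-n).toNat).finite_toSet.subset ?_
    intro x hx
    simp only [Finset.coe_product, Finset.coe_univ, Set.mem_prod, Set.mem_univ, true_and,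
      Finset.mem_coe, Finset.mem_range]
    by_contra h
    exact hx (mem_piFil.1 hn x.1 _ (by omega)))
  map_add' a b := by
    ext x
    rfl
  map_smul' r a := by
    ext x
    rfl

theorem polarPart_apply (a : ι → R⸨X⸩) (x : ι × ℕ) :
    polarPart a x = (a x.1).coeff (-(x.2 : ℤ) - 1) := rfl

/-- The family of Laurent series with given polar part and coefficients. -/
noncomputable def ofParts : (ι × ℕ →₀ R) × (ι × ℕ → R) →ₗ[R] (ι → R⸨X⸩) where
  toFun c j := HahnSeries.ofSuppBddBelow
    (fun n : ℤ => if 0 ≤ n then c.2 (j, n.toNat) else c.1 (j, (-n - 1).toNat)) (by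
      obtain ⟨b, hb⟩ := (c.1.support.image fun x => -(x.2 : ℤ) - 1).bddBelow
      refine ⟨min b 0, fun n hn => ?_⟩
      rcases le_or_gt 0 n with h | h
      · exact (min_le_right _ _).trans h
      · rw [Function.mem_support, if_neg (by omega)] at hn
        refine (min_le_left _ _).trans (hb ?_)
        simp only [Finset.coe_image, Set.mem_image, Finset.mem_coe, Finsupp.mem_support_iff]
        exact ⟨_, hn, by simp only; omega⟩)
  map_add' c d := by
    ext j n
    simp only [Pi.add_apply, HahnSeries.coeff_add, HahnSeries.coeff_ofSuppBddBelow]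
    split_ifs <;> simp
  map_smul' r c := by
    ext j n
    simp only [Pi.smul_apply, HahnSeries.coeff_smul, HahnSeries.coeff_ofSuppBddBelow]
    split_ifs <;> simp

omit [Fintype ι] in
theorem coeff_ofParts (c : (ι × ℕ →₀ R) × (ι × ℕ → R)) (j : ι) (n : ℤ) : (ofParts c j).coeff n =
    if 0 ≤ n then c.2 (j, n.toNat) else c.1 (j, (-n - 1).toNat) := rfl

variable [TopologicalSpace R] [DiscreteTopology R]

-- Polar coefficients form a discrete free module because they vanish on `R[[t]]^ι`; the
-- coefficients of nonnegative degree carry the product topology.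
variable (R ι) in
theorem exists_retract_laurent : ∃ (P : Type (max u v)) (_ : AddCommGroup P) (_ : Module R P)
    (_ : TopologicalSpace P) (_ : DiscreteTopology P) (i : (ι → R⸨X⸩) →L[R] P × (ι × ℕ → R))
    (p : P × (ι × ℕ → R) →L[R] (ι → R⸨X⸩)), Module.Projective R P ∧ ∀ a, p (i a) = a := by
  let τ : TopologicalSpace (ι × ℕ →₀ R) := ⊥
  have : DiscreteTopology (ι × ℕ →₀ R) := ⟨rfl⟩
  let neg : (ι → R⸨X⸩) →L[R] (ι × ℕ →₀ R) := ⟨polarPart, by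
    refine continuous_of_continuousAt_zero polarPart ?_
    rw [ContinuousAt, map_zero]
    refine tendsto_nhds_of_eventually_eq ?_
    filter_upwards [piFil_mem_nhds 0] with a ha
    ext x
    exact mem_piFil.1 ha x.1 _ (by omega)⟩
  let pos : (ι → R⸨X⸩) →L[R] (ι × ℕ → R) :=
    .pi fun x => (coeffSMul (x.2 : ℤ) (1 : R)).comp (.proj x.1)
  have hcont : Continuous (ofParts (R := R) (ι := ι)) := by
    refine continuous_of_continuousAt_zero ofParts ?_
    rw [ContinuousAt, map_zero]
    refine isFil_piFil.basis.tendsto_right_iff.2 fun n _ => ?_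
    have h1 : ({0} : Set (ι × ℕ →₀ R)) ×ˢ
        (vanishing R ((Finset.univ : Finset ι) ×ˢ Finset.range n.toNat) : Set (ι × ℕ → R)) ∈
        𝓝 0 :=
      ((isOpen_discrete _).prod (vanishing_isOpen _)).mem_nhds
        ⟨rfl, Submodule.zero_mem _⟩
    filter_upwards [h1] with c hc
    refine mem_piFil.2 fun j k hk => ?_
    rw [coeff_ofParts]
    split_ifs with h
    · exact hc.2 _ (by simp; omega)
    · rw [show c.1 = 0 from hc.1, Finsupp.zero_apply]
  refine ⟨ι × ℕ →₀ R, inferInstance, inferInstance, τ, this, neg.prod pos, ⟨ofParts, hcont⟩,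
    inferInstance, fun a => ?_⟩
  ext j n
  change (ofParts (polarPart a, pos a) j).coeff n = _
  rw [coeff_ofParts]
  split_ifs with h
  · change (a j).coeff (n.toNat : ℤ) • (1 : R) = _
    rw [smul_eq_mul, mul_one, Int.toNat_of_nonneg h]
  · rw [polarPart_apply]
    congr 1
    simp only
    omega

variable (R ι) in
omit [TopologicalSpace R] [DiscreteTopology R] in
theorem seriesComplete_laurent : SeriesComplete (ι → R⸨X⸩) := by
  let : TopologicalSpace R := ⊥
  have : DiscreteTopology R := ⟨rfl⟩
  obtain ⟨P, _, _, _, _, i, p, -, h⟩ := exists_retract_laurent R ι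
  exact seriesComplete_of_retract i p h

/-- `J → R` is a retract of the dual of the free right module on `J`, by evaluation at the basis. -/
theorem isTateModule_of_retract {M : Type v} [AddCommGroup M] [Module R M] [TopologicalSpace M]
    {P : Type (max u v)} [AddCommGroup P] [Module R P] [TopologicalSpace P] [DiscreteTopology P]
    [Module.Projective R P] {J : Type v} (i : M →L[R] P × (J → R)) (p : P × (J → R) →L[R] M)
    (hpi : ∀ m, p (i m) = m) : IsTateModule R M := by
  let res : RightDual R (J →₀ Rᵐᵒᵖ) →L[R] (J → R) :=
    .pi fun j => (ContinuousLinearMap.proj (R := R) (φ := fun _ => R)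
      (Finsupp.single j (1 : Rᵐᵒᵖ))).comp (rightDualEval R (J →₀ Rᵐᵒᵖ))
  have hres : ∀ x, res (dualOfLinear LinearMap.id x) = x := by
    intro x
    ext j
    change Finsupp.linearCombination Rᵐᵒᵖ x (Finsupp.single j 1) = x j
    rw [Finsupp.linearCombination_single, one_smul]
  refine ⟨P × RightDual R (J →₀ Rᵐᵒᵖ), inferInstance, inferInstance, inferInstance,
    ⟨P, _, _, _, J →₀ Rᵐᵒᵖ, _, _, inferInstance, inferInstance, inferInstance, ⟨.refl R _⟩⟩,
    ((ContinuousLinearMap.id R P).prodMap (dualOfLinear LinearMap.id)).comp i,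
    p.comp ((ContinuousLinearMap.id R P).prodMap res), fun m => ?_⟩
  change p ((i m).1, res (dualOfLinear LinearMap.id (i m).2)) = m
  rw [hres]
  exact hpi m

end Free

/-! ### Surjectivity of the presentation and continuous `R`-linear sections. -/

section Projective

variable {R : Type u} {M : Type v} [Ring R] [AddCommGroup M] [Module R M] [Module R⸨X⸩ M]
  [IsScalarTower R R⸨X⸩ M] [TopologicalSpace M] [IsTopologicalAddGroup M] [ContinuousSMul R⸨X⸩ M]

section Presentation

variable {ι : Type*} [Fintype ι] (x : ι → M)

variable (R) in
/-- The map `R((t)) ^ ι → M` given by a finite family of vectors, as a continuous `R`-linear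
map. -/
noncomputable def presentation : (ι → R⸨X⸩) →L[R] M where
  toLinearMap := (Fintype.linearCombination R⸨X⸩ x).restrictScalars R
  cont := by
    change Continuous fun a : ι → R⸨X⸩ => ∑ j, a j • x j
    fun_prop

theorem presentation_apply (a : ι → R⸨X⸩) : presentation R x a = ∑ j, a j • x j := rfl

theorem presentation_smul (f : R⸨X⸩) (a : ι → R⸨X⸩) :
    presentation R x (f • a) = f • presentation R x a :=
  map_smul (Fintype.linearCombination R⸨X⸩ x) f a

theorem presentation_tpow (k : ℤ) (a : ι → R⸨X⸩) :
    presentation R x (tpow R _ k a) = tpow R M k (presentation R x a) :=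
  presentation_smul x _ a

end Presentation

variable {F : ℤ → Submodule R M} (hF : IsFil F)
  (hshift : ∀ n k m, m ∈ F n → tpow R M k m ∈ F (n + k)) {d : ℕ} (x : Fin d → M)
  (hx : ∀ m ∈ F 0, ∃ r : Fin d → R, m - ∑ j, r j • x j ∈ F 1)

-- Multiplication by `t^(-n)` reduces to the step from `F 0` to `F 1`.
include hshift hx in
theorem exists_presentation_approx {n : ℤ} {m : M} (hm : m ∈ F n) :
    ∃ a ∈ piFil R (Fin d) n, m - presentation R x a ∈ F (n + 1) := by
  have h0 := hshift n (-n) m hm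
  rw [add_neg_cancel] at h0
  obtain ⟨r, hr⟩ := hx _ h0
  refine ⟨fun j => HahnSeries.single n (r j), mem_piFil.2 fun j => single_mem_laurentFil n _, ?_⟩
  have h1 := hshift 1 n _ hr
  rw [map_sub, tpow_tpow, add_neg_cancel, tpow_zero, map_sum, add_comm] at h1
  simpa only [presentation_apply, single_smul, map_smul] using h1

variable {X : Type*} [AddCommGroup X] [Module R X] [TopologicalSpace X] [IsTopologicalAddGroup X]
  [TopologicalSpace R] [DiscreteTopology R] (hX : FinApprox R X)

-- Approximate preimages are chosen only for the finitely many `v (c j)` and extended by the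
-- functionals `l j`, which keeps the lift linear and continuous.
omit [IsTopologicalAddGroup X] in
include hF hshift hx hX in
theorem exists_lift_step {n : ℤ} (v : X →L[R] M) (hv : ∀ ξ, v ξ ∈ F n) :
    ∃ w : X →L[R] (Fin d → R⸨X⸩), (∀ ξ, w ξ ∈ piFil R (Fin d) n) ∧
      ∀ ξ, v ξ - presentation R x (w ξ) ∈ F (n + 1) := by
  obtain ⟨k, l, c, h⟩ := hX ((F (n + 1)).comap (v : X →ₗ[R] M))
    ((hF.isOpen _).preimage v.continuous)
  choose a ha ha' using fun j => exists_presentation_approx hshift x hx (hv (c j))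
  let w : X →L[R] (Fin d → R⸨X⸩) :=
    { toLinearMap := ∑ j, ((l j : X →L[R] R) : X →ₗ[R] R).smulRight (a j)
      cont := by
        have : Continuous fun ξ => ∑ j, l j ξ • a j := continuous_finsetSum _ fun j _ =>
          (continuous_of_discreteTopology (f := fun r : R => r • a j)).comp (l j).continuous
        refine this.congr fun ξ => ?_
        simp [LinearMap.sum_apply] }
  have hw : ∀ ξ, w ξ = ∑ j, l j ξ • a j := fun ξ => by
    change (∑ j, ((l j : X →L[R] R) : X →ₗ[R] R).smulRight (a j)) ξ = _
    simp [LinearMap.sum_apply]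
  refine ⟨w, fun ξ => ?_, fun ξ => ?_⟩
  · rw [hw]
    exact Submodule.sum_mem _ fun j _ => Submodule.smul_mem _ _ (ha j)
  · have h1 : v (ξ - ∑ j, l j ξ • c j) ∈ F (n + 1) := h ξ
    have h2 : ∑ j, l j ξ • (v (c j) - presentation R x (a j)) ∈ F (n + 1) :=
      Submodule.sum_mem _ fun j _ => Submodule.smul_mem _ _ (ha' j)
    have h3 := add_mem h1 h2
    simp only [map_sub, map_sum, map_smul, smul_sub, Finset.sum_sub_distrib] at h3
    rw [hw, map_sum]
    simpa only [map_smul, sub_add_sub_cancel] using h3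

include hF hshift hx hX in
/-- Continuous linear maps from a finitely approximable module lift along the presentation. -/
theorem exists_lift_presentation [T2Space M] (v : X →L[R] M) :
    ∃ s : X →L[R] (Fin d → R⸨X⸩), ∀ ξ, presentation R x (s ξ) = v ξ := by
  obtain ⟨c, hc⟩ := hX.bounded hF v
  choose w hw hw' using fun n v hv => exists_lift_step hF hshift x hx hX (n := n) v hv
  -- `V n` is the error left after `n` corrections; the images of the corrections `u n` telescope to
  -- `v`.
  let V : (n : ℕ) → {v : X →L[R] M // ∀ ξ, v ξ ∈ F (n + c)} := Nat.rec
    ⟨v, by simpa using hc⟩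
    (fun n v => ⟨v.1 - (presentation R x).comp (w _ v.1 v.2), fun ξ => by
      have := hw' _ v.1 v.2 ξ
      rwa [show (n : ℤ) + c + 1 = (n + 1 : ℕ) + c by push_cast; ring] at this⟩)
  let u : ℕ → X →L[R] (Fin d → R⸨X⸩) := fun n => w _ (V n).1 (V n).2
  have hV : ∀ n ξ, presentation R x (u n ξ) = (V n).1 ξ - (V (n + 1)).1 ξ := fun n ξ => by
    change _ = (V n).1 ξ - ((V n).1 ξ - presentation R x (u n ξ))
    rw [sub_sub_cancel]
  have hu : ∀ (n : ℕ) ξ, u n ξ ∈ piFil R (Fin d) (n + c) := fun n ξ => hw _ _ _ ξ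
  have := (isFil_piFil (R := R) (ι := Fin d)).continuousConstSMul
  obtain ⟨s, hs⟩ := exists_sum_continuousLinearMap isFil_piFil (seriesComplete_laurent R (Fin d)) u
    (fun ξ => isFil_piFil.tendsto_zero c fun n => hu n ξ)
    (fun N => ⟨Set.univ, univ_mem, (N - c).toNat, fun n hn ξ _ =>
      isFil_piFil.anti (by omega) (hu n ξ)⟩)
  refine ⟨s, fun ξ => ?_⟩
  have h1 := ((presentation R x).continuous.tendsto _).comp (hs ξ)
  have h2 : Tendsto (fun n => v ξ - (V n).1 ξ) atTop (𝓝 (v ξ - 0)) :=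
    tendsto_const_nhds.sub (hF.tendsto_zero c fun n => (V n).2 ξ)
  rw [sub_zero] at h2
  refine tendsto_nhds_unique (h1.congr fun n => ?_) h2
  rw [Function.comp_apply, map_sum, Finset.sum_congr rfl fun i _ => hV i ξ,
    Finset.sum_range_sub' fun n => (V n).1 ξ]
  rfl

-- A vector `m` is a map `R → M` from discrete `R`, to which the lifting lemma applies.
omit [TopologicalSpace R] [DiscreteTopology R] in
include hF hshift hx in
theorem presentation_surjective [T2Space M] : Function.Surjective (presentation R x) := by
  let : TopologicalSpace R := ⊥
  have : DiscreteTopology R := ⟨rfl⟩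
  intro m
  obtain ⟨s, hs⟩ := exists_lift_presentation hF hshift x hx (finApprox_self R)
    ⟨LinearMap.toSpanSingleton R M m, continuous_of_discreteTopology⟩
  exact ⟨s 1, (hs 1).trans (one_smul R m)⟩

include hF hshift hx in
theorem exists_section [T2Space M] {P J : Type*} [AddCommGroup P] [Module R P]
    [TopologicalSpace P] [DiscreteTopology P] [Module.Projective R P]
    (i : M →L[R] P × (J → R)) (p : P × (J → R) →L[R] M) (hpi : ∀ m, p (i m) = m) :
    ∃ s : M →L[R] (Fin d → R⸨X⸩), ∀ m, presentation R x (s m) = m := by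
  obtain ⟨sP, hsP⟩ := Module.projective_lifting_property
    (presentation R x : (Fin d → R⸨X⸩) →ₗ[R] M)
    ((p : P × (J → R) →ₗ[R] M).comp (LinearMap.inl R P (J → R)))
    (presentation_surjective hF hshift x hx)
  obtain ⟨sJ, hsJ⟩ := exists_lift_presentation hF hshift x hx (finApprox_pi R J)
    (p.comp (ContinuousLinearMap.inr R P (J → R)))
  let sP' : P →L[R] (Fin d → R⸨X⸩) := ⟨sP, continuous_of_discreteTopology⟩
  refine ⟨(sP'.comp (.fst R P (J → R)) + sJ.comp (.snd R P (J → R))).comp i, fun m => ?_⟩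
  change presentation R x (sP (i m).1 + sJ (i m).2) = m
  have h1 : presentation R x (sP (i m).1) = p ((i m).1, 0) := LinearMap.congr_fun hsP (i m).1
  rw [map_add, hsJ, h1]
  change p ((i m).1, 0) + p (0, (i m).2) = m
  rw [← map_add, Prod.mk_add_mk, add_zero, zero_add]
  exact hpi m

end Projective

/-! ### Correcting a section so that it commutes with `t`. -/

section Averaging

variable {R : Type u} {M : Type v} [Ring R] [AddCommGroup M] [Module R M] [Module R⸨X⸩ M]
  [IsScalarTower R R⸨X⸩ M] [TopologicalSpace M] [IsTopologicalAddGroup M] [ContinuousSMul R⸨X⸩ M]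
  {F : ℤ → Submodule R M} (hF : IsFil F)
  (hshift : ∀ n k m, m ∈ F n → tpow R M k m ∈ F (n + k)) {d : ℕ} (x : Fin d → M)

theorem presentation_eq_zero_of_tendsto [T2Space M] {a : ℕ → Fin d → R⸨X⸩} {b : Fin d → R⸨X⸩}
    (h : Tendsto (fun n => ∑ i ∈ Finset.range n, a i) atTop (𝓝 b))
    (ha : ∀ n, presentation R x (a n) = 0) : presentation R x b = 0 := by
  refine tendsto_nhds_unique (((presentation R x).continuous.tendsto _).comp h)
    (tendsto_const_nhds.congr fun n => ?_)
  rw [Function.comp_apply, map_sum, Finset.sum_eq_zero fun i _ => ha i]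

/-- Solving `h T - t h = D` for `D` with bounded image. -/
theorem exists_commutator_of_bounded [T2Space M] (D : M →L[R] (Fin d → R⸨X⸩))
    (hD : ∀ m, presentation R x (D m) = 0) {c : ℤ} (hc : ∀ m, D m ∈ piFil R (Fin d) c) :
    ∃ h : M →L[R] (Fin d → R⸨X⸩), (∀ m, presentation R x (h m) = 0) ∧
      ∀ m, h (tpow R M 1 m) - tpow R _ 1 (h m) = D m := by
  -- Bounded image puts the `n`-th term in `t^(n+c) R[[t]]^d` uniformly in `m`; the commutator with
  -- `t` telescopes.
  let u : ℕ → M →L[R] (Fin d → R⸨X⸩) := fun n =>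
    (tpowL R _ (n : ℤ)).comp (D.comp (tpowL R M (-(n : ℤ) - 1)))
  have hu : ∀ n m, u n m = tpow R _ (n : ℤ) (D (tpow R M (-(n : ℤ) - 1) m)) := fun _ _ => rfl
  have hmem : ∀ (n : ℕ) m, tpow R _ (n : ℤ) (D m) ∈ piFil R (Fin d) (n + c) := fun n m => by
    rw [add_comm]
    exact tpow_mem_piFil (hc m)
  have := (isFil_piFil (R := R) (ι := Fin d)).continuousConstSMul
  obtain ⟨h, hh⟩ := exists_sum_continuousLinearMap isFil_piFil (seriesComplete_laurent R (Fin d)) u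
    (fun m => isFil_piFil.tendsto_zero c fun n => hmem n _)
    (fun N => ⟨Set.univ, univ_mem, (N - c).toNat, fun n hn m _ =>
      isFil_piFil.anti (by omega) (hmem n _)⟩)
  refine ⟨h, fun m => presentation_eq_zero_of_tendsto x (hh m) fun n => ?_, fun m => ?_⟩
  · rw [hu, presentation_tpow, hD, map_zero]
  · let w : ℕ → Fin d → R⸨X⸩ := fun n => tpow R _ (n : ℤ) (D (tpow R M (-(n : ℤ)) m))
    have h1 := (hh (tpow R M 1 m)).sub
      (((continuous_tpow (R := R) (M := Fin d → R⸨X⸩) 1).tendsto _).comp (hh m))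
    have h2 : Tendsto (fun n => D m - w n) atTop (𝓝 (D m - 0)) :=
      tendsto_const_nhds.sub (isFil_piFil.tendsto_zero c fun n => hmem n _)
    rw [sub_zero] at h2
    refine tendsto_nhds_unique (h1.congr fun n => ?_) h2
    rw [Function.comp_apply, map_sum, ← Finset.sum_sub_distrib,
      Finset.sum_congr rfl fun i _ => (?_ : _ = w i - w (i + 1)), Finset.sum_range_sub' w]
    · simp [w]
    · rw [hu, hu, tpow_tpow, tpow_tpow]
      simp only [w]
      congr 3
      · congr 2; ring
      · push_cast; ring
      · congr 3; push_cast; ring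

include hF hshift in
/-- Solving `h T - t h = D` for `D` with open kernel. -/
theorem exists_commutator_of_open_ker [T2Space M] (D : M →L[R] (Fin d → R⸨X⸩))
    (hD : ∀ m, presentation R x (D m) = 0) {b : ℤ} (hb : ∀ m ∈ F b, D m = 0) :
    ∃ h : M →L[R] (Fin d → R⸨X⸩), (∀ m, presentation R x (h m) = 0) ∧
      ∀ m, h (tpow R M 1 m) - tpow R _ 1 (h m) = D m := by
  -- The series runs in the other direction: `t^n m` eventually enters `F b`, so it is finite at
  -- each `m`. The telescoping gives `-D`, hence the witness `-h`.
  let u : ℕ → M →L[R] (Fin d → R⸨X⸩) := fun n =>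
    (tpowL R _ (-(n : ℤ) - 1)).comp (D.comp (tpowL R M (n : ℤ)))
  have hu : ∀ n m, u n m = tpow R _ (-(n : ℤ) - 1) (D (tpow R M (n : ℤ) m)) := fun _ _ => rfl
  have hev : ∀ m, ∀ᶠ n : ℕ in atTop, D (tpow R M (n : ℤ) m) = 0 := fun m => by
    obtain ⟨c, hc⟩ := hF.exh m
    filter_upwards [eventually_ge_atTop (b - c).toNat] with n hn
    exact hb _ (hF.anti (by omega) (hshift _ _ _ hc))
  have := (isFil_piFil (R := R) (ι := Fin d)).continuousConstSMul
  obtain ⟨h, hh⟩ := exists_sum_continuousLinearMap isFil_piFil (seriesComplete_laurent R (Fin d)) u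
    (fun m => tendsto_nhds_of_eventually_eq <| (hev m).mono fun n hn => by
      rw [hu, hn, map_zero])
    (fun N => ⟨F b, hF.basis.mem_of_mem trivial, 0, fun n _ m hm => by
      rw [hu, hb _ (hF.anti (by omega) (hshift _ _ _ hm)), map_zero]
      exact Submodule.zero_mem _⟩)
  refine ⟨-h, fun m => ?_, fun m => ?_⟩
  · change presentation R x (-(h m)) = 0
    rw [map_neg, neg_eq_zero]
    refine presentation_eq_zero_of_tendsto x (hh m) fun n => ?_
    rw [hu, presentation_tpow, hD, map_zero]
  · let w : ℕ → Fin d → R⸨X⸩ := fun n => tpow R _ (-(n : ℤ)) (D (tpow R M (n : ℤ) m))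
    have h1 := (((continuous_tpow (R := R) (M := Fin d → R⸨X⸩) 1).tendsto _).comp (hh m)).sub
      (hh (tpow R M 1 m))
    have h2 : Tendsto (fun n => D m - w n) atTop (𝓝 (D m - 0)) :=
      tendsto_const_nhds.sub (tendsto_nhds_of_eventually_eq <| (hev m).mono fun n hn => by
        simp only [w, hn, map_zero])
    rw [sub_zero] at h2
    change -h (tpow R M 1 m) - tpow R _ 1 (-h m) = D m
    rw [map_neg, neg_sub_neg]
    refine tendsto_nhds_unique (h1.congr fun n => ?_) h2
    rw [Function.comp_apply, map_sum, ← Finset.sum_sub_distrib,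
      Finset.sum_congr rfl fun i _ => (?_ : _ = w i - w (i + 1)), Finset.sum_range_sub' w]
    · simp [w]
    · rw [hu, hu, tpow_tpow, tpow_tpow]
      simp only [w]
      congr 3
      · ring
      · push_cast; ring

variable (hx : ∀ m ∈ F 0, ∃ r : Fin d → R, m - ∑ j, r j • x j ∈ F 1)
  [TopologicalSpace R] [DiscreteTopology R]

include hF hshift hx in
theorem exists_laurent_section [T2Space M] {P J : Type*} [AddCommGroup P] [Module R P]
    [TopologicalSpace P] [DiscreteTopology P] [Module.Projective R P]
    (i : M →L[R] P × (J → R)) (p : P × (J → R) →L[R] M) (hpi : ∀ m, p (i m) = m) :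
    ∃ s : M →L[R] (Fin d → R⸨X⸩), (∀ m, presentation R x (s m) = m) ∧
      ∀ (f : R⸨X⸩) m, s (f • m) = f • s m := by
  obtain ⟨s, hs⟩ := exists_section hF hshift x hx i p hpi
  let D : M →L[R] (Fin d → R⸨X⸩) := (tpowL R _ 1).comp s - s.comp (tpowL R M 1)
  have hDa : ∀ m, D m = tpow R _ 1 (s m) - s (tpow R M 1 m) := fun _ => rfl
  have hD : ∀ m, presentation R x (D m) = 0 := fun m => by
    rw [hDa, map_sub, presentation_tpow, hs, hs, sub_self]
  -- `D` is split along `M → P × (J → R)`: `DJ` is bounded by finite approximation, and the `P`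
  -- component vanishes near `0`.
  let DJ : (J → R) →L[R] (Fin d → R⸨X⸩) := (D.comp p).comp (ContinuousLinearMap.inr R P (J → R))
  let DP : P →L[R] (Fin d → R⸨X⸩) := (D.comp p).comp (ContinuousLinearMap.inl R P (J → R))
  obtain ⟨c, hc⟩ := (finApprox_pi R J).bounded isFil_piFil DJ
  have hker : {m | (i m).1 = 0} ∈ 𝓝 (0 : M) :=
    ((isOpen_discrete ({0} : Set P)).preimage
      (continuous_fst.comp i.continuous)).mem_nhds (by simp)
  obtain ⟨b, -, hb⟩ := hF.basis.mem_iff.1 hker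
  obtain ⟨h₁, hk₁, hc₁⟩ := exists_commutator_of_bounded x
    (DJ.comp ((ContinuousLinearMap.snd R P (J → R)).comp i))
    (fun m => hD _) (fun m => hc _)
  obtain ⟨h₂, hk₂, hc₂⟩ := exists_commutator_of_open_ker hF hshift x
    (DP.comp ((ContinuousLinearMap.fst R P (J → R)).comp i)) (fun m => hD _) (b := b) (fun m hm => by
      change DP (i m).1 = 0
      rw [show (i m).1 = 0 from hb hm, map_zero])
  have hsum : ∀ m, DJ (i m).2 + DP (i m).1 = D m := fun m => by
    change D (p (0, (i m).2)) + D (p ((i m).1, 0)) = D m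
    rw [← map_add, ← map_add, Prod.mk_add_mk, add_zero, zero_add]
    exact congrArg D (hpi m)
  refine ⟨s + h₁ + h₂, fun m => ?_, fun f m => ?_⟩
  · change presentation R x (s m + h₁ m + h₂ m) = m
    rw [map_add, map_add, hs, hk₁, hk₂, add_zero, add_zero]
  · refine map_laurent_smul _ (fun m => ?_) f m
    change s (tpow R M 1 m) + h₁ (tpow R M 1 m) + h₂ (tpow R M 1 m) =
      tpow R _ 1 (s m + h₁ m + h₂ m)
    have e₁ : h₁ (tpow R M 1 m) - tpow R _ 1 (h₁ m) = DJ (i m).2 := hc₁ m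
    have e₂ : h₂ (tpow R M 1 m) - tpow R _ 1 (h₂ m) = DP (i m).1 := hc₂ m
    have e := hsum m
    rw [← e₁, ← e₂, hDa] at e
    rw [map_add, map_add, ← sub_eq_zero]
    rw [← sub_eq_zero] at e
    rw [← e]
    abel

end Averaging

/-! ### From Tate modules to `R((t))`-modules. -/

section TateToLaurent

variable {R : Type u} {M : Type v} [Ring R] [AddCommGroup M] [Module R M] [TopologicalSpace M]

/-- A topologically nilpotent automorphism of a Tate module defines a unique structure of a
topological `R((t))`-module; it is finitely generated projective with standard topology. -/
theorem laurent_of_tate (hM : IsTateModule R M) (T : M ≃L[R] M)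
    (hT : IsTopNilpotentEnd (T : M →L[R] M)) :
    (∃! inst : Module R⸨X⸩ M, IsLaurentStructure R M (T : M →L[R] M) inst) ∧
      ∀ inst : Module R⸨X⸩ M, IsLaurentStructure R M (T : M →L[R] M) inst →
        Module.Finite R⸨X⸩ M ∧ Module.Projective R⸨X⸩ M ∧ IsStandardTopology R M := by
  let : TopologicalSpace R := ⊥
  have : DiscreteTopology R := ⟨rfl⟩
  obtain ⟨P, _, _, _, J, _, _, i, p, hpi⟩ := exists_retract_of_isTateModule hM
  have := isTopologicalAddGroup_of_retract i p hpi
  have := t2Space_of_retract i p hpi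
  obtain ⟨F, hF, hFT, d, x, -, hx⟩ := exists_shifted_filtration
    (fun W hW => exists_isTateLattice_subset i p hpi hW) T hT
  obtain ⟨inst, hinst⟩ := exists_isLaurentStructure hF T hFT (seriesComplete_of_retract i p hpi)
  refine ⟨⟨inst, hinst, fun inst' h' => isLaurentStructure_unique T h' hinst⟩, ?_⟩
  rintro inst ⟨_, _, _, hTt⟩
  have hshift : ∀ n k m, m ∈ F n → tpow R M k m ∈ F (n + k) := fun n k m hm => by
    rw [tpow_eq_zpow T hTt]
    exact hFT n k m hm
  obtain ⟨s, hs, hsl⟩ := exists_laurent_section hF hshift x hx i p hpi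
  let sl : M →ₗ[R⸨X⸩] (Fin d → R⸨X⸩) :=
    { toFun := s, map_add' := map_add s, map_smul' := hsl }
  refine ⟨Module.Finite.of_surjective (Fintype.linearCombination R⸨X⸩ x)
    (presentation_surjective hF hshift x hx),
    Module.Projective.of_split sl (Fintype.linearCombination R⸨X⸩ x) (LinearMap.ext hs),
    inferInstance, inferInstance, fun f => ?_⟩
  -- Linear maps out of `R((t))^d` are automatically continuous, and `f` factors through one via the
  -- continuous section `s`.
  have h1 : Continuous fun m => (f.comp (Fintype.linearCombination R⸨X⸩ x)) (s m) :=
    (LinearMap.continuous_on_pi _).comp s.continuous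
  exact h1.congr fun m => congrArg f (hs m)

end TateToLaurent

/-! ### Standard topologies on finitely generated projective modules. -/

section Standard

variable {R : Type u} {M : Type v} [Ring R] [AddCommGroup M] [Module R⸨X⸩ M]

variable (R M) in
theorem exists_split_of_finite_projective [Module.Finite R⸨X⸩ M] [Module.Projective R⸨X⸩ M] :
    ∃ (ι : Type v) (_ : Fintype ι) (i : M →ₗ[R⸨X⸩] (ι → R⸨X⸩)) (p : (ι → R⸨X⸩) →ₗ[R⸨X⸩] M),
      ∀ m, p (i m) = m := by
  obtain ⟨n, s, hs⟩ := Module.Finite.exists_fin (R := R⸨X⸩) (M := M)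
  -- The lift places the index type in the universe of `M`, as `isTateModule_of_retract` requires.
  let x : ULift.{v} (Fin n) → M := s ∘ ULift.down
  have hsurj : Function.Surjective (Fintype.linearCombination R⸨X⸩ x) := by
    rw [← LinearMap.range_eq_top, Fintype.range_linearCombination,
      Function.Surjective.range_comp ULift.down_surjective, hs]
  obtain ⟨i, hi⟩ := Module.projective_lifting_property _ LinearMap.id hsurj
  exact ⟨_, inferInstance, i, Fintype.linearCombination R⸨X⸩ x, fun m => LinearMap.congr_fun hi m⟩

theorem continuous_to_pi_of_standard [TopologicalSpace M] (h : IsStandardTopology R M)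
    {ι : Type*} (i : M →ₗ[R⸨X⸩] (ι → R⸨X⸩)) : Continuous i :=
  continuous_pi fun j => h.2.2 ((LinearMap.proj j).comp i)

variable {ι : Type*} [Fintype ι] (i : M →ₗ[R⸨X⸩] (ι → R⸨X⸩)) (p : (ι → R⸨X⸩) →ₗ[R⸨X⸩] M)
  (hpi : ∀ m, p (i m) = m)

-- Standardness makes `i` continuous, and `p` is continuous for any topological module structure; so
-- the topology must be the induced one, which gives uniqueness.
include hpi in
theorem isEmbedding_of_standard [TopologicalSpace M] (h : IsStandardTopology R M) :
    Topology.IsEmbedding i := by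
  obtain ⟨_, _, -⟩ := id h
  exact Function.LeftInverse.isEmbedding hpi p.continuous_on_pi (continuous_to_pi_of_standard h i)

include hpi in
theorem existsUnique_standardTopology : ∃! τ : TopologicalSpace M, IsStandardTopology R M := by
  refine ⟨TopologicalSpace.induced i inferInstance, ?_, fun _ hτ =>
    (isEmbedding_of_standard i p hpi hτ).isInducing.eq_induced⟩
  let τ : TopologicalSpace M := TopologicalSpace.induced i inferInstance
  have hi : Topology.IsInducing i := ⟨rfl⟩
  refine ⟨hi.topologicalAddGroup i, hi.continuousSMul continuous_id (map_smul i _ _), fun f => ?_⟩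
  have h1 : Continuous fun m => (f.comp p) (i m) :=
    (LinearMap.continuous_on_pi _).comp hi.continuous
  exact h1.congr fun m => congrArg f (hpi m)

include hpi in
theorem continuous_of_standard [TopologicalSpace M] (h : IsStandardTopology R M) {N : Type*}
    [AddCommGroup N] [Module R⸨X⸩ N] [TopologicalSpace N] [IsTopologicalAddGroup N]
    [ContinuousSMul R⸨X⸩ N] (f : M →ₗ[R⸨X⸩] N) : Continuous f := by
  have h1 : Continuous fun m => (f.comp p) (i m) :=
    (LinearMap.continuous_on_pi _).comp (continuous_to_pi_of_standard h i)
  exact h1.congr fun m => congrArg f (hpi m)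

end Standard

/-! ### From `R((t))`-modules to Tate modules. -/

section LaurentToTate

variable {R : Type u} {M : Type v} [Ring R] [AddCommGroup M] [Module R M] [Module R⸨X⸩ M]
  [IsScalarTower R R⸨X⸩ M] [TopologicalSpace M]

theorem isTateModule_of_standard {ι : Type v} [Fintype ι] (i : M →ₗ[R⸨X⸩] (ι → R⸨X⸩))
    (p : (ι → R⸨X⸩) →ₗ[R⸨X⸩] M) (hpi : ∀ m, p (i m) = m) (h : IsStandardTopology R M) :
    IsTateModule R M := by
  let : TopologicalSpace R := ⊥
  have : DiscreteTopology R := ⟨rfl⟩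
  obtain ⟨_, _, -⟩ := id h
  obtain ⟨P, _, _, _, _, j, q, _, hqj⟩ := exists_retract_laurent R ι
  refine isTateModule_of_retract
    (j.comp ⟨i.restrictScalars R, continuous_to_pi_of_standard h i⟩)
    (ContinuousLinearMap.comp ⟨p.restrictScalars R, p.continuous_on_pi⟩ q) fun m => ?_
  change p (q (j (i m))) = m
  rw [hqj, hpi]

-- Modulo `F 0` a lattice has finitely many generators, and these lie in a common step.
omit [Module R⸨X⸩ M] [IsScalarTower R R⸨X⸩ M] in
theorem isTateLattice_le_filtration [IsTopologicalAddGroup M] {F : ℤ → Submodule R M}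
    (hF : IsFil F) {L : Submodule R M} (hL : IsTateLattice L) : ∃ n, L ≤ F n := by
  rw [isTateLattice_iff] at hL
  obtain ⟨G, hG, hGU⟩ := hL.2 (L ⊓ F 0) (hL.1.inter (hF.isOpen 0)) inf_le_left
  obtain ⟨k, x, rfl⟩ := Submodule.fg_iff_exists_fin_generating_family.1 hG
  obtain ⟨n, hn⟩ := hF.exists_forall_mem Finset.univ x
  refine ⟨min n 0, hGU ▸ sup_le (Submodule.span_le.2 ?_)
    (inf_le_right.trans (hF.anti (min_le_right _ _)))⟩
  rintro _ ⟨j, rfl⟩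
  exact hF.anti (min_le_left _ _) (hn j (Finset.mem_univ j))

/-- Multiplication by `t` as an automorphism. -/
noncomputable def laurentAut [ContinuousSMul R⸨X⸩ M] : M ≃L[R] M :=
  ContinuousLinearEquiv.equivOfInverse (tpowL R M 1) (tpowL R M (-1))
    (fun m => by rw [tpowL_apply, tpowL_apply, tpow_tpow, neg_add_cancel, tpow_zero])
    (fun m => by rw [tpowL_apply, tpowL_apply, tpow_tpow, add_neg_cancel, tpow_zero])

theorem isTopNilpotentEnd_laurentAut [IsTopologicalAddGroup M] [ContinuousSMul R⸨X⸩ M]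
    {F : ℤ → Submodule R M} (hF : IsFil F)
    (hshift : ∀ n k m, m ∈ F n → tpow R M k m ∈ F (n + k)) :
    IsTopNilpotentEnd ((laurentAut : M ≃L[R] M) : M →L[R] M) := by
  intro L L' hL hL'
  obtain ⟨c, hc⟩ := isTateLattice_le_filtration hF hL'
  obtain ⟨b, -, hb⟩ := hF.basis.mem_iff.1 (hL.1.mem_nhds L.zero_mem)
  refine ⟨(b - c).toNat, fun n hn m hm => hb (hF.anti ?_ (?_ : _ ∈ F (c + n)))⟩
  · omega
  · rw [iterate_apply_eq_zpow, ← tpow_eq_zpow laurentAut (fun m => laurentT_smul m)]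
    exact hshift _ _ _ (hc hm)

theorem isFil_comap {ι : Type*} [Fintype ι] (i : M →ₗ[R⸨X⸩] (ι → R⸨X⸩))
    (hi : Topology.IsInducing i) :
    IsFil fun n => (piFil R ι n).comap (i.restrictScalars R) where
  anti _ _ h := Submodule.comap_mono (isFil_piFil.anti h)
  basis := by
    rw [hi.nhds_eq_comap, map_zero]
    exact isFil_piFil.basis.comap _
  exh m := isFil_piFil.exh (i m)

theorem exists_topNilpotent_of_standard {ι : Type*} [Fintype ι] (i : M →ₗ[R⸨X⸩] (ι → R⸨X⸩))
    (p : (ι → R⸨X⸩) →ₗ[R⸨X⸩] M) (hpi : ∀ m, p (i m) = m) (h : IsStandardTopology R M) :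
    ∃ T : M ≃L[R] M, (∀ m, T m = laurentT R • m) ∧ IsTopNilpotentEnd (T : M →L[R] M) := by
  obtain ⟨_, _, -⟩ := id h
  refine ⟨laurentAut, fun m => rfl, isTopNilpotentEnd_laurentAut
    (isFil_comap i (isEmbedding_of_standard i p hpi h).isInducing) fun n k m hm => ?_⟩
  have h1 : i (tpow R M k m) = tpow R _ k (i m) := map_smul i _ m
  change i (tpow R M k m) ∈ piFil R ι (n + k)
  rw [h1]
  exact tpow_mem_piFil hm

end LaurentToTate

end LaurentTate

theorem mainTheorem8 (R : Type u) [Ring R] :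
    -- a Tate module with a topologically nilpotent automorphism `T`
    (∀ (M : Type v) [AddCommGroup M] [Module R M] [TopologicalSpace M], IsTateModule R M →
      ∀ T : M ≃L[R] M, IsTopNilpotentEnd (T : M →L[R] M) →
        (∃! inst : Module R⸨X⸩ M, IsLaurentStructure R M (T : M →L[R] M) inst) ∧
        ∀ inst : Module R⸨X⸩ M, IsLaurentStructure R M (T : M →L[R] M) inst →
          Module.Finite R⸨X⸩ M ∧ Module.Projective R⸨X⸩ M ∧ IsStandardTopology R M) ∧
    -- conversely, a finitely generated projective `R((t))`-module
    (∀ (M : Type v) [AddCommGroup M] [Module R M] [Module R⸨X⸩ M] [IsScalarTower R R⸨X⸩ M],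
      Module.Finite R⸨X⸩ M → Module.Projective R⸨X⸩ M →
        (∃! τ : TopologicalSpace M, IsStandardTopology R M) ∧
        ∀ τ : TopologicalSpace M, IsStandardTopology R M →
          IsTateModule R M ∧
          ∃ T : M ≃L[R] M, (∀ m, T m = laurentT R • m) ∧ IsTopNilpotentEnd (T : M →L[R] M)) ∧
    -- the morphisms are the same
    (∀ (M N : Type v) [AddCommGroup M] [Module R M] [Module R⸨X⸩ M] [IsScalarTower R R⸨X⸩ M]
      [TopologicalSpace M] [AddCommGroup N] [Module R N] [Module R⸨X⸩ N] [IsScalarTower R R⸨X⸩ N]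
      [TopologicalSpace N],
      Module.Finite R⸨X⸩ M → Module.Projective R⸨X⸩ M → IsStandardTopology R M →
      Module.Finite R⸨X⸩ N → Module.Projective R⸨X⸩ N → IsStandardTopology R N →
      ∀ f : M → N,
        (∃ g : M →ₗ[R⸨X⸩] N, ∀ m, g m = f m) ↔
          (∃ g : M →L[R] N, ∀ m, g m = f m) ∧ ∀ m, f (laurentT R • m) = laurentT R • f m) := by
  refine ⟨fun M _ _ _ hM T hT => LaurentTate.laurent_of_tate hM T hT,
    fun M _ _ _ _ _ _ => ?_, fun M N _ _ _ _ _ _ _ _ _ _ _ _ hM _ _ hN f => ⟨?_, ?_⟩⟩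
  · obtain ⟨ι, _, i, p, hpi⟩ := LaurentTate.exists_split_of_finite_projective R M
    exact ⟨LaurentTate.existsUnique_standardTopology i p hpi, fun _ h =>
      ⟨LaurentTate.isTateModule_of_standard i p hpi h,
        LaurentTate.exists_topNilpotent_of_standard i p hpi h⟩⟩
  · rintro ⟨g, hg⟩
    obtain ⟨ι, _, i, p, hpi⟩ := LaurentTate.exists_split_of_finite_projective R M
    obtain ⟨_, _, -⟩ := hN
    refine ⟨⟨⟨g.restrictScalars R, LaurentTate.continuous_of_standard i p hpi hM g⟩, hg⟩,
      fun m => ?_⟩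
    rw [← hg, ← hg, map_smul]
  · rintro ⟨⟨g, hg⟩, hgt⟩
    obtain ⟨ι, _, i, p, hpi⟩ := LaurentTate.exists_split_of_finite_projective R N
    -- The density argument for linearity needs a Hausdorff target.
    have : T2Space N := (LaurentTate.isEmbedding_of_standard i p hpi hN).t2Space
    obtain ⟨_, _, -⟩ := hM
    obtain ⟨_, _, -⟩ := hN
    refine ⟨{ toFun := g, map_add' := map_add g, map_smul' := fun a m =>
      LaurentTate.map_laurent_smul g (fun m => ?_) a m }, hg⟩
    have := hgt m
    rwa [← hg, ← hg] at this
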